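/- **Setting.** Let $\Phi^t:\mathcal M\to\mathcal M$, $t\in\mathbb R$, be a continuous flow on a metric space $\mathcal M$. Let $M\subseteq\mathcal M$ be a forward-invariant, finite-dimensional, compact, connected $C^1$ manifold (boundary and corners allowed) such that the restricted flow map $[0,\infty)\times M\to M$, $(t,x)\mapsto\Phi^t(x)$, is $C^1$. Let $X\subseteq M$ be a compact invariant set carrying an ergodic invariant Borel probability measure $\mu$. Let $V:D(V)\to L^2(\mu)$ be the generator of the unitary Koopman group $U^tf=f\circ\Phi^t$ on the complex space $L^2(\mu)$, that is, $Vf=\lim_{t\to0}(U^tf-f)/t$ on the set $D(V)$ of those $f$ for which the limit exists in $L^2(\mu)$. Let $k:M\times M\to\mathbb R$ be a $C^1$, symmetric, positive-definite kernel, $\mathcal H$ its reproducing kernel Hilbert space of complex-valued functions on $M$, and $K:L^2(\mu)\to\mathcal H$, $Kf=\int k(\cdot,y)f(y)\,d\mu(y)$. Its adjoint $K^*:\mathcal H\to L^2(\mu)$ maps a function to its $L^2(\mu)$ class. Let $G=K^*K$, and call $k$ $L^2(\mu)$-strictly-positive if $G>0$. Let $\mathcal N$ be the Nyström extension operator, with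 domain $D(\mathcal N)=\operatorname{ran}K^*$: for $f\in D(\mathcal N)$, $\mathcal Nf$ is the unique $h\in\overline{\operatorname{ran}K}$ with $K^*h=f$. Set $$k'(x,y)=\frac{d}{dt}\Big|_{t=0^+}k(\Phi^t(x),y),\qquad \tilde k'(x,y)=-k'(y,x),\qquad x,y\in M;$$ the derivative exists and $\tilde k'$ is continuous on $M\times M$. **Theorem.** The operator $A=VG$ is defined on all of $L^2(\mu)$ and bounded. The operator $KVK^*$ (with its natural domain $\{h\in\mathcal H: K^*h\in D(V)\}$) is densely defined and has a unique bounded extension $W:\mathcal H\to\mathcal H$, given by $(Wh)(x)=\int\tilde k'(x,y)h(y)\,d\mu(y)$ for $x\in M$. The operator $B=-A^*:L^2(\mu)\to L^2(\mu)$ is a Hilbert–Schmidt integral operator with kernel $\tilde k'$, i.e. $Bf(x)=\int \tilde k'(x,y)f(y)\,d\mu(y)$ for $\mu$-a.e. $x$. In addition: (i) The densely defined operator $GV:D(V)\to L^2(\mu)$ is bounded and closable, and $B$ is equal to its closure, $B=\overline{GV}=(GV)^{**}$. Moreover, $B$ is a closed extension of $K^*W\mathcal N:D(\mathcal N)\to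 L^2(\mu)$. The kernel $k$ is $L^2(\mu)$-strictly-positive if and only if $D(\mathcal N)$ is dense in $L^2(\mu)$, and in that case $B$ is the only closed operator extending $K^*W\mathcal N$. (ii) $B$ generates a norm-continuous one-parameter group of bounded operators $e^{tB}$, $t\in\mathbb R$, on $L^2(\mu)$, and for all $t\in\mathbb R$ $$K^*e^{tW}=e^{tB}K^*,\qquad K^*e^{tW}\mathcal N=e^{tB}|_{D(\mathcal N)}.$$ -/

import Mathlib

open Set Filter Topology MeasureTheory
open scoped Manifold ContDiff InnerProductSpace LinearPMap

noncomputable section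

/-! ### Operators on Hilbert spaces -/

/-- A bounded operator, regarded as a partially defined operator with domain the whole space. -/
def everywhereDefined {E F : Type*} [NormedAddCommGroup E] [NormedSpace ℂ E]
    [NormedAddCommGroup F] [NormedSpace ℂ F] (T : E →L[ℂ] F) : E →ₗ.[ℂ] F :=
  (T : E →ₗ[ℂ] F).toPMap ⊤

/-- The composition `S T` of a bounded everywhere defined operator `T`, followed by a possibly
unbounded operator `S`, on its natural domain `{x | T x ∈ D(S)}`. -/
def precompBounded {E F G : Type*} [NormedAddCommGroup E] [NormedSpace ℂ E]
    [NormedAddCommGroup F] [NormedSpace ℂ F] [NormedAddCommGroup G] [NormedSpace ℂ G]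
    (S : F →ₗ.[ℂ] G) (T : E →L[ℂ] F) : E →ₗ.[ℂ] G where
  domain := S.domain.comap (T : E →ₗ[ℂ] F)
  toFun := S.toFun ∘ₗ (T : E →ₗ[ℂ] F).restrict (fun _ h => h)

/-- The composition `S T` of a possibly unbounded operator `T`, followed by a bounded everywhere
defined operator `S`; its domain is `D(T)`. -/
def postcompBounded {E F G : Type*} [NormedAddCommGroup E] [NormedSpace ℂ E]
    [NormedAddCommGroup F] [NormedSpace ℂ F] [NormedAddCommGroup G] [NormedSpace ℂ G]
    (S : F →L[ℂ] G) (T : E →ₗ.[ℂ] F) : E →ₗ.[ℂ] G :=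
  (S : F →ₗ[ℂ] G).compPMap T

/-- `T` is Hilbert-Schmidt: `∑ ‖T e‖² < ∞` for the vectors `e` of any orthonormal basis. -/
def IsHilbertSchmidt {E F : Type*} [NormedAddCommGroup E] [InnerProductSpace ℂ E]
    [NormedAddCommGroup F] [InnerProductSpace ℂ F] (T : E →L[ℂ] F) : Prop :=
  ∀ (s : Set E) (b : HilbertBasis s ℂ E), Summable fun i => ‖T (b i)‖ ^ 2

/-- `T > 0`: the quadratic form `⟨f, T f⟩` is real and strictly positive for `f ≠ 0`. -/
def IsStrictlyPositiveOp {E : Type*} [NormedAddCommGroup E] [InnerProductSpace ℂ E]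
    (T : E →L[ℂ] E) : Prop :=
  ∀ f : E, f ≠ 0 → 0 < (⟪f, T f⟫_ℂ).re ∧ (⟪f, T f⟫_ℂ).im = 0

/-! ### Flows, ergodicity, the Koopman group and its generator -/

/-- The flow restricted to a forward-invariant set `M`, for times `t ≥ 0` (negative times are
replaced by `0`, and are never used). -/
def semiflowOn {S : Type*} [TopologicalSpace S] (Φ : Flow ℝ S) {M : Set S}
    (hM : IsForwardInvariant Φ M) (t : ℝ) (x : M) : M :=
  ⟨Φ (max t 0) x, hM (le_max_right t 0) x.2⟩

/-- Ergodicity of a measure under a flow: every measurable set invariant under all time maps has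
zero measure or full measure. -/
def IsErgodicFlow {Y : Type*} [TopologicalSpace Y] [MeasurableSpace Y] (φ : Flow ℝ Y)
    (μ : Measure Y) : Prop :=
  ∀ s : Set Y, MeasurableSet s → (∀ t : ℝ, φ t ⁻¹' s = s) → μ s = 0 ∨ μ sᶜ = 0

/-- The difference quotient `t⁻¹ (U^t f - f)` of the Koopman group `U^t f = f ∘ φ^t` on `L²(μ)`. -/
def koopmanQuotient {Y : Type*} [TopologicalSpace Y] [MeasurableSpace Y] {φ : Flow ℝ Y}
    {μ : Measure Y} (hμ : ∀ t : ℝ, MeasurePreserving (φ t) μ μ) (f : Lp ℂ 2 μ) (t : ℝ) :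
    Lp ℂ 2 μ :=
  (t : ℂ)⁻¹ • (Lp.compMeasurePreserving (φ t) (hμ t) f - f)

theorem koopmanQuotient_add {Y : Type*} [TopologicalSpace Y] [MeasurableSpace Y] {φ : Flow ℝ Y}
    {μ : Measure Y} (hμ : ∀ t : ℝ, MeasurePreserving (φ t) μ μ) (f g : Lp ℂ 2 μ) :
    koopmanQuotient hμ (f + g) = koopmanQuotient hμ f + koopmanQuotient hμ g := by
  funext t
  simp only [koopmanQuotient, Pi.add_apply, map_add, ← smul_add]
  congr 1
  abel

theorem koopmanQuotient_smul {Y : Type*} [TopologicalSpace Y] [MeasurableSpace Y] {φ : Flow ℝ Y}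
    {μ : Measure Y} (hμ : ∀ t : ℝ, MeasurePreserving (φ t) μ μ) (c : ℂ) (f : Lp ℂ 2 μ) :
    koopmanQuotient hμ (c • f) = c • koopmanQuotient hμ f := by
  funext t
  have h : Lp.compMeasurePreserving (φ t) (hμ t) (c • f)
      = c • Lp.compMeasurePreserving (φ t) (hμ t) f :=
    (Lp.compMeasurePreservingₗ ℂ (φ t) (hμ t)).map_smul c f
  simp only [koopmanQuotient, Pi.smul_apply, h, ← smul_sub]
  rw [smul_comm]

/-- The generator `V` of the Koopman group on `L²(μ)`: the domain is the set of all `f` for which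
`t⁻¹ (U^t f - f)` converges in `L²(μ)` as `t → 0`, and `V f` is the limit. -/
def koopmanGenerator {Y : Type*} [TopologicalSpace Y] [MeasurableSpace Y] {φ : Flow ℝ Y}
    {μ : Measure Y} (hμ : ∀ t : ℝ, MeasurePreserving (φ t) μ μ) :
    Lp ℂ 2 μ →ₗ.[ℂ] Lp ℂ 2 μ where
  domain :=
    { carrier := {f | ∃ g, Tendsto (koopmanQuotient hμ f) (𝓝[≠] (0 : ℝ)) (𝓝 g)}
      add_mem' := by
        rintro f f' ⟨g, hg⟩ ⟨g', hg'⟩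
        refine ⟨g + g', ?_⟩
        rw [koopmanQuotient_add]
        exact hg.add hg'
      zero_mem' := by
        refine ⟨0, ?_⟩
        have h : koopmanQuotient hμ (0 : Lp ℂ 2 μ) = fun _ => 0 := by
          funext t
          simp [koopmanQuotient]
        rw [h]
        exact tendsto_const_nhds
      smul_mem' := by
        rintro c f ⟨g, hg⟩
        refine ⟨c • g, ?_⟩
        rw [koopmanQuotient_smul]
        exact hg.const_smul c }
  toFun :=
    { toFun := fun f => limUnder (𝓝[≠] (0 : ℝ)) (koopmanQuotient hμ f)
      map_add' := by
        rintro ⟨f, g, hg⟩ ⟨f', g', hg'⟩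
        have h : Tendsto (koopmanQuotient hμ (f + f')) (𝓝[≠] (0 : ℝ)) (𝓝 (g + g')) := by
          rw [koopmanQuotient_add]
          exact hg.add hg'
        exact h.limUnder_eq.trans (by rw [hg.limUnder_eq, hg'.limUnder_eq])
      map_smul' := by
        rintro c ⟨f, g, hg⟩
        have h : Tendsto (koopmanQuotient hμ (c • f)) (𝓝[≠] (0 : ℝ)) (𝓝 (c • g)) := by
          rw [koopmanQuotient_smul]
          exact hg.const_smul c
        exact h.limUnder_eq.trans (by rw [hg.limUnder_eq, RingHom.id_apply]) }

/-! ### Kernels, reproducing kernel Hilbert spaces and their integral operators -/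

/-- A positive-definite kernel: all kernel matrices on finitely many distinct points are positive
semidefinite. -/
def IsPosDefKernel {M : Type*} (k : M → M → ℝ) : Prop :=
  ∀ (n : ℕ) (x : Fin n → M), Function.Injective x →
    (Matrix.of fun i j => k (x i) (x j)).PosSemidef

/-- `H` is the Hilbert space of complex functions on `M` with reproducing kernel `k`: the Riesz
representative of evaluation at `y` is the kernel section `k(·, y)`. -/
def HasReproducingKernel {M : Type*} (H : Type*) [NormedAddCommGroup H] [InnerProductSpace ℂ H]
    [CompleteSpace H] [RKHS ℂ H M ℂ] (k : M → M → ℝ) : Prop :=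
  ∀ x y : M, (RKHS.kerFun H y (1 : ℂ) : H) x = (k x y : ℂ)

section IntegralOperator

variable {M Y H : Type*} [TopologicalSpace M] [TopologicalSpace Y] [CompactSpace Y]
  [MeasurableSpace Y] [BorelSpace Y] [NormedAddCommGroup H] [InnerProductSpace ℂ H]
  [CompleteSpace H] [RKHS ℂ H M ℂ] {k : M → M → ℝ}

theorem HasReproducingKernel.norm_sub_sq (hH : HasReproducingKernel H k) (x y : M) :
    ‖RKHS.kerFun H x (1 : ℂ) - RKHS.kerFun H y (1 : ℂ)‖ ^ 2
      = k x x - k x y - k y x + k y y := by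
  have h := @inner_self_eq_norm_sq_to_K ℂ H _ _ _
    (RKHS.kerFun H x (1 : ℂ) - RKHS.kerFun H y (1 : ℂ))
  simp only [inner_sub_left, inner_sub_right, RKHS.kerFun_inner, hH _ _] at h
  have h2 := congrArg Complex.re h
  norm_cast at h2
  simp only [RCLike.inner_apply, map_one, mul_one, Complex.sub_re, Complex.ofReal_re] at h2
  have h3 : _ = ‖RKHS.kerFun H x (1 : ℂ) - RKHS.kerFun H y (1 : ℂ)‖ ^ 2 :=
    h2.trans (Complex.ofReal_re _)
  linarith

theorem HasReproducingKernel.continuous_kerFun (hH : HasReproducingKernel H k)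
    (hk : Continuous fun p : M × M => k p.1 p.2) :
    Continuous fun x : M => (RKHS.kerFun H x (1 : ℂ) : H) := by
  rw [continuous_iff_continuousAt]
  intro y
  rw [ContinuousAt, tendsto_iff_norm_sub_tendsto_zero]
  have h1 : Continuous fun x : M => k x x - k x y - k y x + k y y :=
    (((hk.comp (continuous_id.prodMk continuous_id)).sub
      (hk.comp (continuous_id.prodMk continuous_const))).sub
      (hk.comp (continuous_const.prodMk continuous_id))).add continuous_const
  have h2 : Tendsto (fun x : M => √(k x x - k x y - k y x + k y y)) (𝓝 y) (𝓝 0) := by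
    have := (Real.continuous_sqrt.comp h1).tendsto y
    simpa [Function.comp_def] using this
  refine h2.congr fun x => ?_
  rw [← hH.norm_sub_sq, Real.sqrt_sq (norm_nonneg _)]

/-- The bounded operator `K : L²(μ) → H` induced by the kernel exists: for every `f ∈ L²(μ)` the
function `x ↦ ∫ k(x, y) f(y) dμ(y)` on `M` belongs to `H`. Here `j : Y → M` is the inclusion of the
compact set that carries `μ`. Its adjoint sends `h ∈ H` to the `L²(μ)`-class of `h`. -/
theorem exists_rkhsIntegralOp (hH : HasReproducingKernel H k)
    (hk : Continuous fun p : M × M => k p.1 p.2) (j : C(Y, M)) (μ : Measure Y)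
    [IsFiniteMeasure μ] :
    ∃ K : Lp ℂ 2 μ →L[ℂ] H,
      (∀ (f : Lp ℂ 2 μ) (x : M), K f x = ∫ y, (k x (j y) : ℂ) * f y ∂μ) ∧
      (∀ h : H, ⇑(ContinuousLinearMap.adjoint K h) =ᵐ[μ] fun y => h (j y)) := by
  have hc := (hH.continuous_kerFun hk).comp j.continuous
  obtain ⟨C, hC⟩ : ∃ C, ∀ y : Y, ‖(RKHS.kerFun H (j y) (1 : ℂ) : H)‖ ≤ C := by
    obtain ⟨C, hC⟩ := isCompact_univ.exists_bound_of_continuousOn hc.continuousOn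
    exact ⟨C, fun y => hC y (mem_univ y)⟩
  have hev : ∀ (h : H) (x : M), h x = ⟪(RKHS.kerFun H x (1 : ℂ) : H), h⟫_ℂ := by
    intro h x
    simp
  have hcont : ∀ h : H, Continuous fun y : Y => h (j y) := by
    intro h
    have : Continuous fun y : Y => ⟪(RKHS.kerFun H (j y) (1 : ℂ) : H), h⟫_ℂ :=
      hc.inner continuous_const
    exact this.congr fun y => (hev h (j y)).symm
  let L : H →ₗ[ℂ] C(Y, ℂ) :=
    { toFun := fun h => ⟨fun y => h (j y), hcont h⟩
      map_add' := fun h h' => by ext y; simp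
      map_smul' := fun c h => by ext y; simp }
  have hL : ∀ h : H, ‖L h‖ ≤ |C| * ‖h‖ := by
    intro h
    rw [ContinuousMap.norm_le _ (by positivity)]
    intro y
    change ‖h (j y)‖ ≤ _
    rw [hev]
    refine (norm_inner_le_norm _ _).trans ?_
    gcongr
    exact (hC y).trans (le_abs_self C)
  let J : H →L[ℂ] Lp ℂ 2 μ := (ContinuousMap.toLp 2 μ ℂ) ∘L (L.mkContinuous |C| hL)
  have hJ : ∀ h : H, ⇑(J h) =ᵐ[μ] fun y => h (j y) := fun h =>
    ContinuousMap.coeFn_toLp (p := 2) μ (𝕜 := ℂ) (L h)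
  refine ⟨ContinuousLinearMap.adjoint J, ?_, ?_⟩
  · intro f x
    rw [hev, ContinuousLinearMap.adjoint_inner_right, L2.inner_def]
    refine integral_congr_ae ?_
    filter_upwards [hJ (RKHS.kerFun H x (1 : ℂ))] with y hy
    have hs : (k (j y) x : ℂ) = k x (j y) := by
      have h1 := hH (j y) x
      have h2 := hH x (j y)
      rw [hev, ← inner_conj_symm, ← hev, h2, Complex.conj_ofReal] at h1
      exact h1.symm
    rw [hy, hH, hs]
    simp [mul_comm]
  · intro h
    rw [ContinuousLinearMap.adjoint_adjoint]
    exact hJ h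

/-- The integral operator `K : L²(μ) → H`, `(K f)(x) = ∫ k(x, y) f(y) dμ(y)` for `x ∈ M`. -/
def rkhsIntegralOp (hH : HasReproducingKernel H k)
    (hk : Continuous fun p : M × M => k p.1 p.2) (j : C(Y, M)) (μ : Measure Y)
    [IsFiniteMeasure μ] : Lp ℂ 2 μ →L[ℂ] H :=
  (exists_rkhsIntegralOp hH hk j μ).choose

theorem rkhsIntegralOp_apply (hH : HasReproducingKernel H k)
    (hk : Continuous fun p : M × M => k p.1 p.2) (j : C(Y, M)) (μ : Measure Y)
    [IsFiniteMeasure μ] (f : Lp ℂ 2 μ) (x : M) :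
    rkhsIntegralOp hH hk j μ f x = ∫ y, (k x (j y) : ℂ) * f y ∂μ :=
  (exists_rkhsIntegralOp hH hk j μ).choose_spec.1 f x

theorem rkhsIntegralOp_adjoint (hH : HasReproducingKernel H k)
    (hk : Continuous fun p : M × M => k p.1 p.2) (j : C(Y, M)) (μ : Measure Y)
    [IsFiniteMeasure μ] (h : H) :
    ⇑(ContinuousLinearMap.adjoint (rkhsIntegralOp hH hk j μ) h) =ᵐ[μ] fun y => h (j y) :=
  (exists_rkhsIntegralOp hH hk j μ).choose_spec.2 h

end IntegralOperator

/-- The Nyström extension operator of `K : L² → H`: the inverse of the restriction of `K^*` to the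
closure of `ran K` (on which `K^*` is injective). Its domain is `ran K^*`, and it maps `f` to the
unique element `h` of the closure of `ran K` with `K^* h = f`. -/
def nystromOp {L H : Type*} [NormedAddCommGroup L] [InnerProductSpace ℂ L] [CompleteSpace L]
    [NormedAddCommGroup H] [InnerProductSpace ℂ H] [CompleteSpace H] (K : L →L[ℂ] H) :
    L →ₗ.[ℂ] H :=
  ((ContinuousLinearMap.adjoint K : H →ₗ[ℂ] L).toPMap
    (LinearMap.range (K : L →ₗ[ℂ] H)).topologicalClosure).inverse

/-- The derivative at time `0` of a function on `M` along the flow, `lim_{t → 0+} (f(Φ^t x) - f(x))/t`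
(only forward orbits need to stay in `M`). -/
def derivAlongFlow {S : Type*} [TopologicalSpace S] (Φ : Flow ℝ S) {M : Set S}
    (hM : IsForwardInvariant Φ M) (f : M → ℝ) (x : M) : ℝ :=
  derivWithin (fun t : ℝ => f (semiflowOn Φ hM t x)) (Ici 0) 0

end

noncomputable section

/-! ### Derivatives of a kernel along the flow -/

section FlowDerivative

variable {S : Type*} [MetricSpace S] {Φ : Flow ℝ S} {M : Set S} (hM : IsForwardInvariant Φ M)

/-! Since `k` is only $C^1$, nothing can be differentiated in both variables, and the boundedness of
$KVK^*$ must come from symmetry instead. Three facts carry the proof.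

By compactness the difference quotients of $k$ along the flow converge uniformly; on the invariant
set $X$ this holds for both signs of $t$. So $Gf$, the class of a continuous function, lies in
$D(V)$, and $A=VG$ is the integral operator with kernel $k'$. Transposing, $B=-A^*$ has kernel
$\tilde k'$. As $V$ is skew-symmetric and densely defined, $GV\subseteq-(VG)^*=B$, which makes $B$
the closure of $GV$.

Skew-symmetry of $V$ also gives $\langle KAf,Kg\rangle=\langle VGf,Gg\rangle=-\langle
Kf,KAg\rangle$. A bounded operator that is skew for a semi-inner product is bounded in its seminorm
(`norm_map_le_of_skew`), so $Kf\mapsto KAf$ extends to a bounded $W$, zero on $\ker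
K^*=(\operatorname{ran}K)^\perp$. Then $W^*=-W$, which identifies $W$ with $KVK^*$ on its natural
domain and, tested on kernel sections, gives the integral formula.

Finally $K^*W=BK^*$, since both sides are $GVG$ on $\operatorname{ran}K$ and vanish on $\ker K^*$.
With $K^*\mathcal N=\mathrm{id}$ on $D(\mathcal N)$, this yields the statements on $K^*W\mathcal N$
and, power by power, those on the exponentials. -/

theorem semiflowOn_zero (x : M) : semiflowOn Φ hM 0 x = x := by
  ext; simp [semiflowOn]

theorem semiflowOn_add {s t : ℝ} (hs : 0 ≤ s) (ht : 0 ≤ t) (x : M) :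
    semiflowOn Φ hM (s + t) x = semiflowOn Φ hM s (semiflowOn Φ hM t x) := by
  ext
  simp [semiflowOn, hs, ht, add_nonneg hs ht, Φ.map_add]

theorem continuous_semiflowOn : Continuous fun p : ℝ × M => semiflowOn Φ hM p.1 p.2 := by
  refine Continuous.subtype_mk ?_ _
  exact Φ.continuous (by fun_prop) (by fun_prop)

variable {k : M → M → ℝ}

section Manifold

variable {E E₀ : Type*} [NormedAddCommGroup E] [NormedSpace ℝ E] [TopologicalSpace E₀]
  {I : ModelWithCorners ℝ E E₀} [ChartedSpace E₀ M]
  (hΦ : ContMDiffOn (𝓘(ℝ, ℝ).prod I) I 1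
    (fun p : ℝ × M => semiflowOn Φ hM p.1 p.2) (Ici (0 : ℝ) ×ˢ univ))
  (hk : ContMDiff (I.prod I) 𝓘(ℝ, ℝ) 1 (fun p : M × M => k p.1 p.2))

include hΦ hk

theorem contMDiffOn_kernel_semiflowOn :
    ContMDiffOn ((I.prod I).prod 𝓘(ℝ, ℝ)) 𝓘(ℝ, ℝ) 1
      (fun q : (M × M) × ℝ => k (semiflowOn Φ hM q.2 q.1.1) q.1.2) (univ ×ˢ Ici (0 : ℝ)) := by
  have h1 : ContMDiffOn ((I.prod I).prod 𝓘(ℝ, ℝ)) I 1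
      (fun q : (M × M) × ℝ => semiflowOn Φ hM q.2 q.1.1) (univ ×ˢ Ici (0 : ℝ)) := by
    refine hΦ.comp (t := Ici (0 : ℝ) ×ˢ univ) (f := fun q : (M × M) × ℝ => (q.2, q.1.1)) ?_ ?_
    · exact (contMDiff_snd.prodMk (contMDiff_fst.comp contMDiff_fst)).contMDiffOn
    · intro q hq
      exact ⟨hq.2, mem_univ _⟩
  exact hk.comp_contMDiffOn (h1.prodMk (contMDiff_snd.comp contMDiff_fst).contMDiffOn)

theorem hasDerivWithinAt_kernel_semiflowOn (x y : M) :
    HasDerivWithinAt (fun t : ℝ => k (semiflowOn Φ hM t x) y)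
      (derivAlongFlow Φ hM (fun z => k z y) x) (Ici 0) 0 := by
  have h : ContMDiffOn 𝓘(ℝ, ℝ) 𝓘(ℝ, ℝ) 1 (fun t : ℝ => k (semiflowOn Φ hM t x) y) (Ici 0) :=
    (contMDiffOn_kernel_semiflowOn hM hΦ hk).comp (f := fun t : ℝ => ((x, y), t))
      (contMDiff_const.prodMk contMDiff_id).contMDiffOn (fun t ht => ⟨mem_univ _, ht⟩)
  rw [contMDiffOn_iff_contDiffOn] at h
  exact ((h.differentiableOn one_ne_zero) 0 self_mem_Ici).hasDerivWithinAt

/-- The $t$-derivative at $0$ of a jointly $C^1$ function depends continuously on the parameters: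
one order of smoothness is lost, from 1 to 0. -/
theorem continuous_derivAlongFlow [IsManifold I 1 M] :
    Continuous fun p : M × M => derivAlongFlow Φ hM (fun z => k z p.2) p.1 := by
  rw [continuous_iff_continuousAt]
  intro p
  have h := ContMDiffWithinAt.mfderivWithin (m := 0) (n := 1) (t := univ) (u := Ici (0 : ℝ))
    (f := fun (p : M × M) (t : ℝ) => k (semiflowOn Φ hM t p.1) p.2) (g := fun _ => (0 : ℝ))
    (x₀ := p) (contMDiffOn_kernel_semiflowOn hM hΦ hk _ ⟨mem_univ _, self_mem_Ici⟩)
    contMDiffWithinAt_const (mem_univ _) (fun _ _ => self_mem_Ici) (by simp)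
    (uniqueDiffOn_Ici 0).uniqueMDiffOn
  -- The tangent bundle of $\mathbb R$ is trivial, so the coordinate expression is the derivative
  -- itself.
  have e := inTangentCoordinates_model_space (I := 𝓘(ℝ, ℝ)) (I' := 𝓘(ℝ, ℝ)) (fun _ : M × M => (0 : ℝ))
    (fun p : M × M => k (semiflowOn Φ hM 0 p.1) p.2)
    (fun p => mfderivWithin 𝓘(ℝ, ℝ) 𝓘(ℝ, ℝ) (fun t : ℝ => k (semiflowOn Φ hM t p.1) p.2) (Ici 0) 0) p
  have h2 : ContinuousAt (fun p : M × M =>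
      (fderivWithin ℝ (fun t : ℝ => k (semiflowOn Φ hM t p.1) p.2) (Ici 0) 0 : ℝ →L[ℝ] ℝ)) p := by
    refine ((continuousWithinAt_univ _ _).1 h.continuousWithinAt).congr
      (Eventually.of_forall fun q => ?_)
    exact (congrFun e q).trans mfderivWithin_eq_fderivWithin
  exact ContinuousAt.clm_apply h2 (continuousAt_const (y := (1 : ℝ)))

end Manifold

variable {k' : M → M → ℝ} (hk : Continuous fun p : M × M => k p.1 p.2)
  (hd : ∀ x y, HasDerivWithinAt (fun t : ℝ => k (semiflowOn Φ hM t x) y) (k' x y) (Ici 0) 0)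
  (hk' : Continuous fun p : M × M => k' p.1 p.2)

include hd in
-- The semigroup law moves the base point from $x$ to $\Phi^s(x)$, which reduces time $s$ to time
-- $0$.
theorem hasDerivWithinAt_semiflowOn_of_nonneg {s : ℝ} (hs : 0 ≤ s) (x y : M) :
    HasDerivWithinAt (fun t : ℝ => k (semiflowOn Φ hM t x) y)
      (k' (semiflowOn Φ hM s x) y) (Ici s) s := by
  have h := hd (semiflowOn Φ hM s x) y
  have h1 : HasDerivWithinAt (fun t : ℝ => t - s) 1 (Ici s) s :=
    ((hasDerivAt_id s).sub_const s).hasDerivWithinAt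
  have h2 := HasDerivWithinAt.scomp_of_eq s h h1 (fun t ht => mem_Ici.2 (sub_nonneg.2 (mem_Ici.1 ht))) (sub_self s).symm
  rw [one_smul] at h2
  refine h2.congr (fun t ht => ?_) ?_
  · simp only [Function.comp]
    rw [← semiflowOn_add hM (sub_nonneg.2 ht) hs, sub_add_cancel]
  · simp [semiflowOn_zero]

variable [CompactSpace M]

include hk hd hk' in
/-- The difference quotients of the kernel along the flow converge uniformly, with base point
anywhere on a short orbit segment. -/
theorem exists_uniform_derivative {ε : ℝ} (hε : 0 < ε) :
    ∃ δ > 0, ∀ t, 0 ≤ t → t < δ → ∀ x y : M,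
      |k (semiflowOn Φ hM t x) y - k x y - t * k' x y| ≤ ε * t ∧
      |k' (semiflowOn Φ hM t x) y - k' x y| ≤ ε := by
  have hc : Continuous fun q : ℝ × M × M => k' (semiflowOn Φ hM q.1 q.2.1) q.2.2 :=
    hk'.comp (((continuous_semiflowOn hM).comp (by fun_prop : Continuous
      fun q : ℝ × M × M => (q.1, q.2.1))).prodMk (by fun_prop))
  -- Currying gives a continuous curve in $C(M\times M)$, where convergence is uniform convergence
  -- because $M\times M$ is compact.
  have hu : TendstoUniformlyOn (fun (t : ℝ) (p : M × M) => k' (semiflowOn Φ hM t p.1) p.2)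
      (fun p => k' (semiflowOn Φ hM 0 p.1) p.2) (𝓝 0) univ := by
    have hc' : Continuous fun t : ℝ => (⟨fun p : M × M => k' (semiflowOn Φ hM t p.1) p.2,
        hc.comp (by fun_prop : Continuous fun p : M × M => (t, p))⟩ : C(M × M, ℝ)) :=
      ContinuousMap.continuous_of_continuous_uncurry _ hc
    have := (ContinuousMap.tendsto_iff_tendstoUniformly.1 (hc'.tendsto 0))
    rw [tendstoUniformlyOn_univ]
    exact this
  rw [Metric.tendstoUniformlyOn_iff] at hu
  obtain ⟨δ, hδ, h⟩ := Metric.eventually_nhds_iff.1 (hu ε hε)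
  have key : ∀ t, 0 ≤ t → t < δ → ∀ x y : M,
      |k' (semiflowOn Φ hM t x) y - k' x y| ≤ ε := by
    intro t ht htδ x y
    have := h (y := t) (by rwa [Real.dist_eq, sub_zero, abs_of_nonneg ht]) (x, y) (mem_univ _)
    rw [dist_comm, Real.dist_eq] at this
    simp only [semiflowOn_zero] at this
    exact this.le
  refine ⟨δ, hδ, fun t ht htδ x y => ⟨?_, key t ht htδ x y⟩⟩
  -- Mean value inequality for the orbit function minus its linear part, whose right derivative is
  -- at most $\varepsilon$ in absolute value.
  have := norm_image_sub_le_of_norm_deriv_right_le_segment (a := 0) (b := t)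
    (f := fun s => k (semiflowOn Φ hM s x) y - s * k' x y)
    (f' := fun s => k' (semiflowOn Φ hM s x) y - k' x y) (C := ε) ?_ ?_ ?_ t ⟨ht, le_rfl⟩
  · simp only [semiflowOn_zero, Real.norm_eq_abs, zero_mul, sub_zero] at this
    convert this using 2
    ring
  · refine Continuous.continuousOn (Continuous.sub ?_ (by fun_prop))
    exact hk.comp (((continuous_semiflowOn hM).comp (by fun_prop : Continuous
      fun s : ℝ => (s, x))).prodMk continuous_const)
  · intro s hs
    refine (hasDerivWithinAt_semiflowOn_of_nonneg hM hd hs.1 x y).sub ?_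
    simpa using ((hasDerivAt_id s).mul_const (k' x y)).hasDerivWithinAt (s := Ici s)
  · intro s hs
    exact key s hs.1 (hs.2.trans htδ) x y

include hk hd hk' in
/-- On an invariant subset, the two-sided difference quotients of the kernel along the flow converge
uniformly. -/
theorem exists_uniform_derivative_two_sided {X : Set S} (hXM : X ⊆ M) (hX : IsInvariant Φ X)
    {ε : ℝ} (hε : 0 < ε) :
    ∃ δ > 0, ∀ t : ℝ, |t| < δ → ∀ (x : X) (y : M),
      |k (inclusion hXM (Φ.restrict hX t x)) y - k (inclusion hXM x) y
        - t * k' (inclusion hXM x) y| ≤ ε * |t| := by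
  obtain ⟨δ, hδ, h⟩ := exists_uniform_derivative hM hk hd hk' (half_pos hε)
  have hsf : ∀ t, 0 ≤ t → ∀ x : X,
      semiflowOn Φ hM t (inclusion hXM x) = inclusion hXM (Φ.restrict hX t x) := by
    intro t ht x
    ext
    simp [semiflowOn, ht]
  refine ⟨δ, hδ, fun t ht x y => ?_⟩
  rcases le_total 0 t with h0 | h0
  · rw [abs_of_nonneg h0] at ht ⊢
    have := (h t h0 ht (inclusion hXM x) y).1
    rw [hsf t h0] at this
    nlinarith
  -- For $t\le0$, flow forward by $-t$ from $\Phi^t(x)$ back to $x$. One $\varepsilon/2$ pays for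
  -- the difference quotient based at $\Phi^t(x)$, the other for replacing $k'(\Phi^t(x),y)$ by
  -- $k'(x,y)$.
  · rw [abs_of_nonpos h0] at ht ⊢
    have h1 := h (-t) (by linarith) ht (inclusion hXM (Φ.restrict hX t x)) y
    have h2 : Φ.restrict hX (-t) (Φ.restrict hX t x) = x := by
      rw [← Flow.map_add, neg_add_cancel, Flow.map_zero_apply]
    rw [hsf _ (by linarith), h2] at h1
    obtain ⟨h3, h4⟩ := h1
    have h5 := mul_le_mul_of_nonneg_left h4 (by linarith : 0 ≤ -t)
    rw [abs_le] at h3 ⊢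
    rw [← abs_of_nonneg (by linarith : 0 ≤ -t), ← abs_mul, abs_of_nonneg (by linarith : 0 ≤ -t),
      abs_le] at h5
    constructor <;> nlinarith

end FlowDerivative

/-! ### The Koopman group and its generator -/

section Koopman

variable {Y : Type*} [MetricSpace Y] [CompactSpace Y] [MeasurableSpace Y] [BorelSpace Y]
  {φ : Flow ℝ Y} {μ : Measure Y} [IsFiniteMeasure μ] (hμ : ∀ t : ℝ, MeasurePreserving (φ t) μ μ)

theorem continuous_koopman (f : Lp ℂ 2 μ) :
    Continuous fun t : ℝ => Lp.compMeasurePreserving (φ t) (hμ t) f := by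
  have h : Continuous fun t : ℝ => (⟨φ t, φ.continuous_toFun t⟩ : C(Y, Y)) :=
    ContinuousMap.continuous_of_continuous_uncurry _ φ.cont'
  exact (continuous_const (y := f)).compMeasurePreservingLp h hμ (by simp)

theorem koopman_add (s t : ℝ) (f : Lp ℂ 2 μ) :
    Lp.compMeasurePreserving (φ s) (hμ s) (Lp.compMeasurePreserving (φ t) (hμ t) f)
      = Lp.compMeasurePreserving (φ (s + t)) (hμ (s + t)) f := by
  apply Lp.ext
  have h1 := Lp.coeFn_compMeasurePreserving (Lp.compMeasurePreserving (φ t) (hμ t) f) (hμ s)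
  have h2 := Lp.coeFn_compMeasurePreserving f (hμ t)
  have h3 := Lp.coeFn_compMeasurePreserving f (hμ (s + t))
  filter_upwards [h1, (hμ s).quasiMeasurePreserving.ae h2, h3] with x hx1 hx2 hx3
  rw [hx1, Function.comp_apply, hx2, hx3, Function.comp_apply, Function.comp_apply, ← φ.map_add,
    add_comm]

theorem koopman_zero (f : Lp ℂ 2 μ) : Lp.compMeasurePreserving (φ 0) (hμ 0) f = f := by
  apply Lp.ext
  filter_upwards [Lp.coeFn_compMeasurePreserving f (hμ 0)] with x hx
  rw [hx, Function.comp_apply, φ.map_zero_apply]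

/-- $U^t$ is an isometry with right inverse $U^{-t}$, so $U^{-t}$ is its adjoint. -/
theorem inner_koopman (t : ℝ) (f g : Lp ℂ 2 μ) :
    ⟪Lp.compMeasurePreserving (φ t) (hμ t) f, g⟫_ℂ
      = ⟪f, Lp.compMeasurePreserving (φ (-t)) (hμ (-t)) g⟫_ℂ := by
  let U : Lp ℂ 2 μ →ₗᵢ[ℂ] Lp ℂ 2 μ :=
    Lp.compMeasurePreservingₗᵢ ℂ (φ t) (hμ t)
  have h := U.inner_map_map f (Lp.compMeasurePreserving (φ (-t)) (hμ (-t)) g)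
  have h2 : U (Lp.compMeasurePreserving (φ (-t)) (hμ (-t)) g) = g := by
    change Lp.compMeasurePreserving (φ t) (hμ t) _ = g
    rw [koopman_add]
    convert koopman_zero hμ g
    rw [add_neg_cancel]
  rw [h2] at h
  exact h

variable {hμ} in
theorem mem_koopmanGenerator_domain {f g : Lp ℂ 2 μ}
    (h : Tendsto (koopmanQuotient hμ f) (𝓝[≠] (0 : ℝ)) (𝓝 g)) :
    f ∈ (koopmanGenerator hμ).domain := ⟨g, h⟩

variable {hμ} in
theorem koopmanGenerator_apply {f : (koopmanGenerator hμ).domain} {g : Lp ℂ 2 μ}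
    (h : Tendsto (koopmanQuotient hμ f) (𝓝[≠] (0 : ℝ)) (𝓝 g)) :
    koopmanGenerator hμ f = g := h.limUnder_eq

theorem tendsto_koopmanQuotient (f : (koopmanGenerator hμ).domain) :
    Tendsto (koopmanQuotient hμ f) (𝓝[≠] (0 : ℝ)) (𝓝 (koopmanGenerator hμ f)) := by
  obtain ⟨g, hg⟩ := f.2
  rwa [koopmanGenerator_apply hg]

/-- The adjoint of the difference quotient at $t$ is minus the quotient at $-t$; let $t\to0$. -/
theorem inner_koopmanGenerator (f g : (koopmanGenerator hμ).domain) :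
    ⟪koopmanGenerator hμ f, (g : Lp ℂ 2 μ)⟫_ℂ = -⟪(f : Lp ℂ 2 μ), koopmanGenerator hμ g⟫_ℂ := by
  have h1 := (tendsto_koopmanQuotient hμ f).inner (tendsto_const_nhds (x := (g : Lp ℂ 2 μ)))
    (𝕜 := ℂ)
  have hneg : Tendsto (fun t : ℝ => -t) (𝓝[≠] 0) (𝓝[≠] 0) := by
    refine tendsto_nhdsWithin_iff.2 ⟨?_, ?_⟩
    · simpa using (continuous_neg.tendsto (0 : ℝ)).mono_left nhdsWithin_le_nhds
    · filter_upwards [self_mem_nhdsWithin] with t ht using neg_ne_zero.2 ht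
  have h2 := ((tendsto_const_nhds (x := (f : Lp ℂ 2 μ))).inner
    ((tendsto_koopmanQuotient hμ g).comp hneg) (𝕜 := ℂ)).neg
  refine tendsto_nhds_unique h1 (h2.congr fun t => ?_)
  simp only [koopmanQuotient, Function.comp, inner_smul_left, inner_smul_right, inner_sub_left,
    inner_sub_right, inner_koopman hμ t]
  simp

/-- The time averages `∫₀^δ U^s f ds` lie in the domain of the generator. -/
theorem integral_koopman_mem_domain (f : Lp ℂ 2 μ) (δ : ℝ) :
    (∫ s in (0 : ℝ)..δ, Lp.compMeasurePreserving (φ s) (hμ s) f) ∈ (koopmanGenerator hμ).domain := by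
  set u : ℝ → Lp ℂ 2 μ := fun s => Lp.compMeasurePreserving (φ s) (hμ s) f with hu
  have hc : Continuous u := continuous_koopman hμ f
  have hi : ∀ a b, IntervalIntegrable u volume a b := fun a b => hc.intervalIntegrable a b
  have hshift : ∀ t, Lp.compMeasurePreserving (φ t) (hμ t) (∫ s in (0 : ℝ)..δ, u s)
      = ∫ s in t..(t + δ), u s := by
    intro t
    let U : Lp ℂ 2 μ →L[ℂ] Lp ℂ 2 μ :=
      (Lp.compMeasurePreservingₗᵢ ℂ (φ t) (hμ t)).toContinuousLinearMap
    change U _ = _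
    rw [← U.intervalIntegral_comp_comm (hi 0 δ)]
    have : ∀ s, U (u s) = u (t + s) := fun s => koopman_add hμ t s f
    simp_rw [this]
    rw [intervalIntegral.integral_comp_add_left, add_zero]
  -- $U^t$ only shifts the window of integration, so the derivative at $0$ is the difference of the
  -- endpoint values.
  have hd : HasDerivAt (fun t : ℝ => ∫ s in t..(t + δ), u s) (u δ - u 0) 0 := by
    have h1 : ∀ x, HasDerivAt (fun t : ℝ => ∫ s in (0 : ℝ)..t, u s) (u x) x := fun x =>
      intervalIntegral.integral_hasDerivAt_right (hi _ _) (hc.stronglyMeasurableAtFilter _ _)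
        hc.continuousAt
    have h2 : HasDerivAt (fun t : ℝ => ∫ s in (0 : ℝ)..(t + δ), u s) (u δ) 0 := by
      have := (h1 (0 + δ)).comp_add_const 0 δ
      rwa [zero_add] at this
    refine (h2.sub (h1 0)).congr_of_eventuallyEq (Eventually.of_forall fun t => ?_)
    exact (intervalIntegral.integral_interval_sub_left (hi _ _) (hi _ _)).symm
  rw [hasDerivAt_iff_tendsto_slope] at hd
  refine mem_koopmanGenerator_domain (g := u δ - u 0) (hd.congr fun t => ?_)
  rw [koopmanQuotient, hshift, slope, sub_zero, vsub_eq_sub, zero_add, ← Complex.ofReal_inv,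
    Complex.coe_smul]
  rfl

/-- By strong continuity, $f$ is the limit of its averages $t^{-1}\int_0^tU^sf\,ds$, which lie in
the domain. -/
theorem dense_koopmanGenerator_domain :
    Dense ((koopmanGenerator hμ).domain : Set (Lp ℂ 2 μ)) := by
  intro f
  set u : ℝ → Lp ℂ 2 μ := fun s => Lp.compMeasurePreserving (φ s) (hμ s) f with hu
  have hc : Continuous u := continuous_koopman hμ f
  have hd : HasDerivAt (fun t : ℝ => ∫ s in (0 : ℝ)..t, u s) (u 0) 0 :=
    intervalIntegral.integral_hasDerivAt_right (hc.intervalIntegrable _ _)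
      (hc.stronglyMeasurableAtFilter _ _) hc.continuousAt
  rw [hasDerivAt_iff_tendsto_slope, show u 0 = f from koopman_zero hμ f] at hd
  refine mem_closure_of_tendsto hd (Eventually.of_forall fun t => ?_)
  rw [slope, sub_zero, vsub_eq_sub, intervalIntegral.integral_same, sub_zero]
  exact Submodule.smul_of_tower_mem _ _ (integral_koopman_mem_domain hμ f t)

/-- A continuous function that is uniformly differentiable along the flow lies in the domain of the
generator. -/
theorem tendsto_koopmanQuotient_toLp (F F' : C(Y, ℂ))
    (h : ∀ ε > 0, ∃ δ > 0, ∀ t : ℝ, |t| < δ → ∀ x, ‖F (φ t x) - F x - t * F' x‖ ≤ ε * |t|) :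
    Tendsto (koopmanQuotient hμ (ContinuousMap.toLp 2 μ ℂ F)) (𝓝[≠] (0 : ℝ))
      (𝓝 (ContinuousMap.toLp 2 μ ℂ F')) := by
  -- The quotients converge already in the sup norm; the continuous map `toLp` carries the limit to
  -- $L^2$.
  let Q : ℝ → C(Y, ℂ) := fun t =>
    (t : ℂ)⁻¹ • (F.comp ⟨φ t, φ.continuous_toFun t⟩ - F)
  have hQ : ∀ t, koopmanQuotient hμ (ContinuousMap.toLp 2 μ ℂ F) t
      = ContinuousMap.toLp 2 μ ℂ (Q t) := by
    intro t
    simp only [koopmanQuotient, Q, map_smul, map_sub]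
    refine congrArg (fun g => (t : ℂ)⁻¹ • (g - _)) ?_
    apply Lp.ext
    have h1 := Lp.coeFn_compMeasurePreserving (ContinuousMap.toLp 2 μ ℂ F) (hμ t)
    have h2 := ContinuousMap.coeFn_toLp (p := 2) μ (𝕜 := ℂ) F
    have h3 := ContinuousMap.coeFn_toLp (p := 2) μ (𝕜 := ℂ) (F.comp ⟨φ t, φ.continuous_toFun t⟩)
    filter_upwards [h1, (hμ t).quasiMeasurePreserving.ae h2, h3] with x hx1 hx2 hx3
    rw [hx1, hx3, Function.comp_apply, hx2]
    rfl
  refine Tendsto.congr (fun t => (hQ t).symm) ?_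
  refine ((ContinuousMap.toLp 2 μ ℂ).continuous.tendsto F').comp ?_
  rw [Metric.tendsto_nhdsWithin_nhds]
  intro ε hε
  obtain ⟨δ, hδ, hh⟩ := h (ε / 2) (half_pos hε)
  refine ⟨δ, hδ, fun t ht htδ => ?_⟩
  rw [Real.dist_eq, sub_zero] at htδ
  rw [dist_eq_norm]
  refine lt_of_le_of_lt ?_ (half_lt_self hε)
  rw [ContinuousMap.norm_le _ (half_pos hε).le]
  intro x
  have ht0 : (t : ℂ) ≠ 0 := Complex.ofReal_ne_zero.2 ht
  have e : (Q t - F') x = (t : ℂ)⁻¹ * (F (φ t x) - F x - t * F' x) := by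
    simp only [Q, ContinuousMap.sub_apply, ContinuousMap.smul_apply, ContinuousMap.comp_apply,
      ContinuousMap.coe_mk, smul_eq_mul]
    field_simp
  rw [e, norm_mul, norm_inv, Complex.norm_real, Real.norm_eq_abs,
    inv_mul_le_iff₀ (abs_pos.2 ht), mul_comm |t|]
  exact hh t htδ x

end Koopman

/-! ### Integral operators with continuous kernels on `L²` -/

section IntegralOperators

variable {Y : Type*} [MetricSpace Y] [CompactSpace Y] [MeasurableSpace Y] [BorelSpace Y]
  (μ : Measure Y) [IsFiniteMeasure μ]

theorem inner_toLp_star (u : C(Y, ℂ)) (f : Lp ℂ 2 μ) :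
    ⟪ContinuousMap.toLp 2 μ ℂ (star u), f⟫_ℂ = ∫ y, u y * f y ∂μ := by
  rw [L2.inner_def]
  refine integral_congr_ae ?_
  filter_upwards [ContinuousMap.coeFn_toLp (p := 2) μ (𝕜 := ℂ) (star u)] with y hy
  rw [hy]
  simp [mul_comm]

/-- The operator `f ↦ ∫ c(·, y) f(y) dμ(y)` from `L²(μ)` to continuous functions. -/
def kernelIntegral (c : C(Y × Y, ℂ)) : Lp ℂ 2 μ →L[ℂ] C(Y, ℂ) :=
  LinearMap.mkContinuousOfExistsBound
    { toFun := fun f => ⟨fun x => ⟪ContinuousMap.toLp 2 μ ℂ (star (c.curry x)), f⟫_ℂ,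
        Continuous.inner ((ContinuousMap.toLp 2 μ ℂ).continuous.comp
          (continuous_star.comp c.curry.continuous)) continuous_const⟩
      map_add' := fun f g => by ext x; simp [inner_add_right]
      map_smul' := fun a f => by ext x; simp [inner_smul_right] }
    ⟨‖ContinuousMap.toLp 2 μ ℂ (E := ℂ)‖ * ‖c.curry‖, fun f => by
      rw [ContinuousMap.norm_le _ (by positivity)]
      intro x
      refine (norm_inner_le_norm (𝕜 := ℂ)
        (ContinuousMap.toLp 2 μ ℂ (star (c.curry x))) f).trans ?_
      gcongr
      refine (ContinuousLinearMap.le_opNorm _ _).trans ?_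
      rw [norm_star]
      gcongr
      exact c.curry.norm_coe_le_norm x⟩

theorem kernelIntegral_eq_inner (c : C(Y × Y, ℂ)) (f : Lp ℂ 2 μ) (x : Y) :
    kernelIntegral μ c f x = ⟪ContinuousMap.toLp 2 μ ℂ (star (c.curry x)), f⟫_ℂ := rfl

theorem kernelIntegral_apply (c : C(Y × Y, ℂ)) (f : Lp ℂ 2 μ) (x : Y) :
    kernelIntegral μ c f x = ∫ y, c (x, y) * f y ∂μ :=
  (kernelIntegral_eq_inner μ c f x).trans (inner_toLp_star μ _ f)

/-- The integral operator on `L²(μ)` with continuous kernel `c`. -/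
def kernelOp (c : C(Y × Y, ℂ)) : Lp ℂ 2 μ →L[ℂ] Lp ℂ 2 μ :=
  ContinuousMap.toLp 2 μ ℂ ∘L kernelIntegral μ c

theorem coeFn_kernelOp (c : C(Y × Y, ℂ)) (f : Lp ℂ 2 μ) :
    ⇑(kernelOp μ c f) =ᵐ[μ] fun x => ∫ y, c (x, y) * f y ∂μ := by
  filter_upwards [ContinuousMap.coeFn_toLp (p := 2) μ (𝕜 := ℂ) (kernelIntegral μ c f)] with x hx
  rw [← kernelIntegral_apply]
  exact hx

theorem integrable_of_L2 (f : Lp ℂ 2 μ) : Integrable f μ :=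
  (Lp.memLp f).integrable (by norm_num)

/-- Fubini, applicable since `c` is bounded and $L^2\subseteq L^1$ for a finite measure. -/
theorem adjoint_kernelOp {c d : C(Y × Y, ℂ)} (h : ∀ x y, d (x, y) = star (c (y, x))) :
    ContinuousLinearMap.adjoint (kernelOp μ c) = kernelOp μ d := by
  symm
  rw [ContinuousLinearMap.eq_adjoint_iff]
  intro g f
  rw [L2.inner_def, L2.inner_def]
  have hint : Integrable (Function.uncurry fun x y => c (x, y) * (star (g x) * f y))
      (μ.prod μ) := by
    have h1 : Integrable (fun z : Y × Y => star (g z.1) * f z.2) (μ.prod μ) :=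
      (Complex.conjCLE.toContinuousLinearMap.integrable_comp (integrable_of_L2 μ g)).mul_prod (integrable_of_L2 μ f)
    exact h1.bdd_mul (c := ‖c‖) c.continuous.aestronglyMeasurable
      (Eventually.of_forall fun z => c.norm_coe_le_norm z)
  calc ∫ y, ⟪kernelOp μ d g y, f y⟫_ℂ ∂μ
      = ∫ y, ∫ x, c (x, y) * (star (g x) * f y) ∂μ ∂μ := by
        refine integral_congr_ae ?_
        filter_upwards [coeFn_kernelOp μ d g] with y hy
        rw [hy, RCLike.inner_apply, ← integral_conj, ← integral_const_mul]
        refine integral_congr_ae (Eventually.of_forall fun x => ?_)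
        simp [h]
        ring
    _ = ∫ x, ∫ y, c (x, y) * (star (g x) * f y) ∂μ ∂μ := (integral_integral_swap hint).symm
    _ = ∫ x, ⟪g x, kernelOp μ c f x⟫_ℂ ∂μ := by
        refine integral_congr_ae ?_
        filter_upwards [coeFn_kernelOp μ c f] with x hx
        rw [hx, RCLike.inner_apply, ← integral_mul_const]
        refine integral_congr_ae (Eventually.of_forall fun y => ?_)
        simp
        ring

theorem kernelOp_neg (c : C(Y × Y, ℂ)) : kernelOp μ (-c) = -kernelOp μ c := by
  ext1 f
  apply Lp.ext
  rw [neg_apply]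
  filter_upwards [coeFn_kernelOp μ c f, coeFn_kernelOp μ (-c) f, Lp.coeFn_neg (kernelOp μ c f)]
    with x h1 h2 h3
  rw [h2, h3, Pi.neg_apply, h1, ← integral_neg]
  simp

/-- For fixed $x$, the values at $x$ of the images of the basis are inner products with the section
$\overline{c(x,\cdot)}$. Bessel's inequality bounds their square sum uniformly in $x$; integrate
over $x$. -/
theorem isHilbertSchmidt_kernelOp (c : C(Y × Y, ℂ)) : IsHilbertSchmidt (kernelOp μ c) := by
  intro s b
  set D : ℝ := (‖ContinuousMap.toLp 2 μ ℂ (E := ℂ)‖ * ‖c.curry‖) ^ 2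
  have hnorm : ∀ f : Lp ℂ 2 μ, ‖kernelOp μ c f‖ ^ 2 = ∫ x, ‖kernelIntegral μ c f x‖ ^ 2 ∂μ := by
    intro f
    have h := inner_self_eq_norm_sq_to_K (𝕜 := ℂ) (kernelOp μ c f)
    rw [kernelOp, ContinuousLinearMap.comp_apply, ContinuousMap.inner_toLp] at h
    have h2 : ∀ x, kernelIntegral μ c f x * (starRingEnd ℂ) (kernelIntegral μ c f x)
        = ((‖kernelIntegral μ c f x‖ ^ 2 : ℝ) : ℂ) := fun x => by
      rw [Complex.mul_conj, Complex.normSq_eq_norm_sq]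
    simp_rw [h2] at h
    have h3 := (integral_ofReal (𝕜 := ℂ) (μ := μ)
      (f := fun x => ‖kernelIntegral μ c f x‖ ^ 2)).symm.trans h
    exact (by exact_mod_cast h3.symm)
  have hi : ∀ f : Lp ℂ 2 μ, Integrable (fun x => ‖kernelIntegral μ c f x‖ ^ 2) μ := fun f =>
    ((kernelIntegral μ c f).continuous.norm.pow 2).integrable_of_hasCompactSupport
      (HasCompactSupport.of_compactSpace _)
  refine summable_of_sum_le (c := ∫ _, D ∂μ) (fun i => by positivity) fun u => ?_
  simp_rw [hnorm]
  rw [← integral_finsetSum _ fun i _ => hi _]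
  refine integral_mono (integrable_finsetSum _ fun i _ => hi _) (integrable_const _) fun x => ?_
  calc ∑ i ∈ u, ‖kernelIntegral μ c (b i) x‖ ^ 2
      = ∑ i ∈ u, ‖⟪b i, ContinuousMap.toLp 2 μ ℂ (star (c.curry x))⟫_ℂ‖ ^ 2 := by
        refine Finset.sum_congr rfl fun i _ => ?_
        rw [kernelIntegral_eq_inner, norm_inner_symm]
    _ ≤ ‖ContinuousMap.toLp 2 μ ℂ (star (c.curry x))‖ ^ 2 := b.orthonormal.sum_inner_products_le _
    _ ≤ D := by
        refine pow_le_pow_left₀ (norm_nonneg _) ?_ 2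
        refine (ContinuousLinearMap.le_opNorm _ _).trans ?_
        rw [norm_star]
        gcongr
        exact c.curry.norm_coe_le_norm x

/-- If a kernel is differentiable along a flow, uniformly in both variables, then so are the
functions in the range of its integral operator. -/
theorem kernelIntegral_uniform_derivative {φ : Flow ℝ Y} {c c' : C(Y × Y, ℂ)}
    (h : ∀ ε > 0, ∃ δ > 0, ∀ t : ℝ, |t| < δ → ∀ x y,
      ‖c (φ t x, y) - c (x, y) - t * c' (x, y)‖ ≤ ε * |t|) (f : Lp ℂ 2 μ) :
    ∀ ε > 0, ∃ δ > 0, ∀ t : ℝ, |t| < δ → ∀ x,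
      ‖kernelIntegral μ c f (φ t x) - kernelIntegral μ c f x - t * kernelIntegral μ c' f x‖
        ≤ ε * |t| := by
  intro ε hε
  set D : ℝ := ∫ y, ‖f y‖ ∂μ with hD
  have hD0 : 0 ≤ D := integral_nonneg fun _ => norm_nonneg _
  -- `D + 1` rather than `D`, since the $L^1$ norm of `f` may vanish.
  obtain ⟨δ, hδ, hh⟩ := h (ε / (D + 1)) (by positivity)
  refine ⟨δ, hδ, fun t ht x => ?_⟩
  have hi : ∀ (e : C(Y × Y, ℂ)) (x : Y), Integrable (fun y => e (x, y) * f y) μ := fun e x =>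
    (integrable_of_L2 μ f).bdd_mul (c := ‖e‖)
      (e.continuous.comp (by fun_prop : Continuous fun y => (x, y))).aestronglyMeasurable
      (Eventually.of_forall fun y => e.norm_coe_le_norm _)
  rw [kernelIntegral_apply, kernelIntegral_apply, kernelIntegral_apply, ← integral_const_mul,
    ← integral_sub (hi _ _) (hi _ _),
    ← integral_sub (f := fun y => c (φ t x, y) * f y - c (x, y) * f y)
      ((hi _ _).sub (hi _ _)) ((hi _ _).const_mul _)]
  calc ‖∫ y, (c (φ t x, y) * f y - c (x, y) * f y - t * (c' (x, y) * f y)) ∂μ‖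
      ≤ ∫ y, (ε / (D + 1) * |t|) * ‖f y‖ ∂μ := by
        refine norm_integral_le_of_norm_le ((integrable_of_L2 μ f).norm.const_mul _)
          (Eventually.of_forall fun y => ?_)
        rw [show c (φ t x, y) * f y - c (x, y) * f y - t * (c' (x, y) * f y)
          = (c (φ t x, y) - c (x, y) - t * c' (x, y)) * f y by ring, norm_mul]
        gcongr
        exact hh t ht x y
    _ = (D / (D + 1)) * (ε * |t|) := by rw [integral_const_mul, ← hD]; ring
    _ ≤ 1 * (ε * |t|) := by
        gcongr
        rw [div_le_one (by positivity)]
        linarith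
    _ = ε * |t| := one_mul _

end IntegralOperators

/-! ### Operators that are skew-symmetric for a degenerate inner product -/

section AbstractOperators

variable {L H : Type*} [NormedAddCommGroup L] [InnerProductSpace ℂ L] [CompleteSpace L]
  [NormedAddCommGroup H] [InnerProductSpace ℂ H] [CompleteSpace H]

/-- A bounded operator that is skew-symmetric for the semi-inner product `⟨K f, K g⟩` is bounded for
the corresponding seminorm. -/
theorem norm_map_le_of_skew {K : L →L[ℂ] H} {T : L →L[ℂ] L}
    (h : ∀ f g, ⟪K (T f), K g⟫_ℂ = -⟪K f, K (T g)⟫_ℂ) (f : L) : ‖K (T f)‖ ≤ ‖T‖ * ‖K f‖ := by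
  have hpow : ∀ (n : ℕ) (f g : L), ‖⟪K ((T ^ n) f), K g⟫_ℂ‖ = ‖⟪K f, K ((T ^ n) g)⟫_ℂ‖ := by
    intro n
    induction n with
    | zero => intro f g; rfl
    | succ n ih =>
      intro f g
      rw [pow_succ', mul_apply_eq_comp, h, norm_neg, ih, ← mul_apply_eq_comp,
        ← pow_succ, ← pow_succ']
  have hsq : ∀ n : ℕ, ‖K ((T ^ n) f)‖ ^ 2 ≤ ‖K f‖ * ‖K ((T ^ (2 * n)) f)‖ := by
    intro n
    have h1 : ‖⟪K ((T ^ n) f), K ((T ^ n) f)⟫_ℂ‖ = ‖K ((T ^ n) f)‖ ^ 2 := by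
      rw [inner_self_eq_norm_sq_to_K]
      simp
    rw [← h1, hpow, ← mul_apply_eq_comp, ← pow_add, ← two_mul]
    exact norm_inner_le_norm _ _
  -- Iterated Cauchy–Schwarz: $(\|KTf\|/\|Kf\|)^{2^m}\le\|KT^{2^m}f\|/\|Kf\|$, cleared of
  -- denominators so that $Kf=0$ is allowed.
  have hiter : ∀ m : ℕ, ‖K (T f)‖ ^ (2 ^ m) * ‖K f‖ ≤ ‖K f‖ ^ (2 ^ m) * ‖K ((T ^ (2 ^ m)) f)‖ := by
    intro m
    induction m with
    | zero => simp [mul_comm]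
    | succ m ih =>
      rcases (norm_nonneg (K f)).eq_or_lt with h0 | h0
      · rw [← h0, mul_zero]
        positivity
      · have h2 := pow_le_pow_left₀ (by positivity) ih 2
        have h3 := mul_le_mul_of_nonneg_left (hsq (2 ^ m))
          (by positivity : 0 ≤ (‖K f‖ ^ (2 ^ m)) ^ 2)
        rw [mul_pow, mul_pow] at h2
        have h4 := h2.trans h3
        refine le_of_mul_le_mul_right ?_ h0
        rw [pow_succ 2 m, pow_mul, pow_mul, mul_comm (2 ^ m) 2]
        nlinarith [h4]
  -- If the bound failed, then $r<1$ and $r^{2^m}\to0$ would force $Kf=0$; then `hsq 1` gives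
  -- $KTf=0$, a contradiction.
  by_contra! hlt
  have h1 : 0 < ‖K (T f)‖ := lt_of_le_of_lt (by positivity) hlt
  set r := ‖T‖ * ‖K f‖ / ‖K (T f)‖ with hr
  have hr0 : 0 ≤ r := by positivity
  have hr1 : r < 1 := (div_lt_one h1).2 hlt
  have hbound : ∀ m : ℕ, ‖K f‖ ≤ r ^ (2 ^ m) * (‖K‖ * ‖f‖) := by
    intro m
    have h2 : ‖K ((T ^ (2 ^ m)) f)‖ ≤ ‖T‖ ^ (2 ^ m) * (‖K‖ * ‖f‖) := by
      calc ‖K ((T ^ (2 ^ m)) f)‖ ≤ ‖K‖ * (‖T ^ (2 ^ m)‖ * ‖f‖) :=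
            (K.le_opNorm _).trans (by gcongr; exact ContinuousLinearMap.le_opNorm _ _)
        _ ≤ ‖K‖ * (‖T‖ ^ (2 ^ m) * ‖f‖) := by
            gcongr
            exact norm_pow_le' T (by positivity)
        _ = _ := by ring
    have h3 := (hiter m).trans (mul_le_mul_of_nonneg_left h2 (by positivity))
    rw [hr, div_pow, mul_pow, div_mul_eq_mul_div, le_div_iff₀ (by positivity)]
    linarith
  have hlim : Tendsto (fun m : ℕ => r ^ (2 ^ m) * (‖K‖ * ‖f‖)) atTop (𝓝 (0 * (‖K‖ * ‖f‖))) :=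
    ((tendsto_pow_atTop_nhds_zero_of_lt_one hr0 hr1).comp
      (tendsto_pow_atTop_atTop_of_one_lt one_lt_two)).mul_const _
  rw [zero_mul] at hlim
  have hK : ‖K f‖ = 0 := le_antisymm (ge_of_tendsto' hlim hbound) (norm_nonneg _)
  have := hsq 1
  rw [hK, zero_mul, pow_one] at this
  nlinarith

/-- The bounded extension to `H` of the operator `K f ↦ K (T f)` on `ran K`, by zero on the
orthogonal complement. -/
theorem exists_transport {K : L →L[ℂ] H} {T : L →L[ℂ] L}
    (h : ∀ f g, ⟪K (T f), K g⟫_ℂ = -⟪K f, K (T g)⟫_ℂ) :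
    ∃ W : H →L[ℂ] H, (∀ f, W (K f) = K (T f)) ∧
      (∀ u, ContinuousLinearMap.adjoint K u = 0 → W u = 0) := by
  set R : Submodule ℂ H := (LinearMap.range (K : L →ₗ[ℂ] H)).topologicalClosure with hR
  have hmem : ∀ f, K f ∈ R := fun f =>
    Submodule.le_topologicalClosure _ (LinearMap.mem_range_self (K : L →ₗ[ℂ] H) f)
  let e : L →ₗ[ℂ] R := (K : L →ₗ[ℂ] H).codRestrict R hmem
  have hdense : DenseRange e := by
    intro u
    have hu : (u : H) ∈ closure (range K) := u.2
    rw [closure_subtype]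
    convert hu
    ext v
    simp [e]
  have : CompleteSpace R :=
    (Submodule.isClosed_topologicalClosure _).completeSpace_coe
  -- The seminorm bound makes $Kf\mapsto KTf$ both well defined and continuous on
  -- $\operatorname{ran}K$.
  let W₀ : R →L[ℂ] H := ((K ∘L T : L →L[ℂ] H) : L →ₗ[ℂ] H).extendOfNorm e
  have hW₀ : ∀ f, W₀ (e f) = K (T f) := fun f =>
    LinearMap.extendOfNorm_eq hdense ⟨‖T‖, fun g => norm_map_le_of_skew h g⟩ f
  refine ⟨W₀ ∘L R.orthogonalProjectionOnto, fun f => ?_, fun u hu => ?_⟩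
  · rw [ContinuousLinearMap.comp_apply, ← hW₀]
    congr 1
    exact Submodule.orthogonalProjectionOnto_mem_subspace_eq_self (e f)
  · rw [ContinuousLinearMap.comp_apply,
      Submodule.orthogonalProjectionOnto_apply_of_mem_orthogonal, map_zero]
    rw [hR, Submodule.orthogonal_closure]
    rw [show (LinearMap.range (K : L →ₗ[ℂ] H))ᗮ = _ from K.orthogonal_range]
    exact hu

/-- Two bounded operators that agree on `ran K` and on `ker K^*` are equal. -/
theorem eq_of_eq_on_range_of_eq_on_ker {F : Type*} [NormedAddCommGroup F] [NormedSpace ℂ F]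
    {K : L →L[ℂ] H} {P Q : H →L[ℂ] F} (h1 : ∀ f, P (K f) = Q (K f))
    (h2 : ∀ u, ContinuousLinearMap.adjoint K u = 0 → P u = Q u) : P = Q := by
  set R : Submodule ℂ H := (LinearMap.range (K : L →ₗ[ℂ] H)).topologicalClosure with hR
  have : CompleteSpace R := (Submodule.isClosed_topologicalClosure _).completeSpace_coe
  have hle : R ≤ LinearMap.eqLocus (P : H →ₗ[ℂ] F) (Q : H →ₗ[ℂ] F) := by
    refine Submodule.topologicalClosure_minimal _ ?_ (isClosed_eq P.continuous Q.continuous)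
    rintro _ ⟨f, rfl⟩
    exact h1 f
  ext u
  obtain ⟨v, hv, w, hw, rfl⟩ := R.exists_add_mem_mem_orthogonal u
  rw [hR, Submodule.orthogonal_closure,
    show (LinearMap.range (K : L →ₗ[ℂ] H))ᗮ = _ from K.orthogonal_range] at hw
  rw [map_add, map_add, h2 w hw, show P v = Q v from hle hv]

/-- If `W` extends `K T K⁻¹` by zero and `K T` is skew-symmetric for `⟨K f, K g⟩`, then `W` is
skew-adjoint. -/
theorem adjoint_transport {K : L →L[ℂ] H} {T : L →L[ℂ] L}
    (h : ∀ f g, ⟪K (T f), K g⟫_ℂ = -⟪K f, K (T g)⟫_ℂ) {W : H →L[ℂ] H}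
    (hW : ∀ f, W (K f) = K (T f)) (hW0 : ∀ u, ContinuousLinearMap.adjoint K u = 0 → W u = 0) :
    ContinuousLinearMap.adjoint W = -W := by
  -- The range of `W` is orthogonal to $\ker K^*$, as $W$ maps $\operatorname{ran}K$ into itself and
  -- kills the complement.
  have horth : ∀ u, ContinuousLinearMap.adjoint K u = 0 → ∀ v, ⟪W v, u⟫_ℂ = 0 := by
    intro u hu v
    let ψ : H →L[ℂ] ℂ := (innerSL ℂ u) ∘L W
    have : ψ = 0 := by
      refine eq_of_eq_on_range_of_eq_on_ker (K := K) (fun f => ?_) (fun w hw => ?_)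
      · simp only [ψ, ContinuousLinearMap.comp_apply, hW, innerSL_apply_apply,
          zero_apply]
        rw [← ContinuousLinearMap.adjoint_inner_left, hu, inner_zero_left]
      · simp [ψ, hW0 w hw]
    have h2 : ⟪u, W v⟫_ℂ = 0 := DFunLike.congr_fun this v
    exact inner_eq_zero_symm.1 h2
  refine eq_of_eq_on_range_of_eq_on_ker (K := K) (fun f => ?_) (fun u hu => ?_)
  · refine ext_inner_left ℂ fun v => ?_
    rw [ContinuousLinearMap.adjoint_inner_right, neg_apply, inner_neg_right, hW]
    let ψ : H →L[ℂ] ℂ := (innerSL ℂ (K f)) ∘L W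
    have : ψ = -innerSL ℂ (K (T f)) := by
      refine eq_of_eq_on_range_of_eq_on_ker (K := K) (fun g => ?_) (fun w hw => ?_)
      · simp only [ψ, ContinuousLinearMap.comp_apply, hW, innerSL_apply_apply,
          neg_apply]
        rw [h, neg_neg]
      · simp only [ψ, ContinuousLinearMap.comp_apply, hW0 w hw, map_zero, innerSL_apply_apply,
          neg_apply]
        rw [← ContinuousLinearMap.adjoint_inner_right, hw, inner_zero_right, neg_zero]
    have h2 : ⟪K f, W v⟫_ℂ = -⟪K (T f), v⟫_ℂ := DFunLike.congr_fun this v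
    rw [← inner_conj_symm, h2, map_neg, inner_conj_symm]
  · refine ext_inner_left ℂ fun v => ?_
    rw [ContinuousLinearMap.adjoint_inner_right, horth u hu v, neg_apply,
      hW0 u hu, neg_zero, inner_zero_right]

end AbstractOperators

/-! ### Skew-symmetric generators and their transport by `K` -/

section GeneratorTransport

variable {L H : Type*} [NormedAddCommGroup L] [InnerProductSpace ℂ L] [CompleteSpace L]
  [NormedAddCommGroup H] [InnerProductSpace ℂ H] [CompleteSpace H]
  {V : L →ₗ.[ℂ] L} {K : L →L[ℂ] H} {A : L →L[ℂ] L}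

/-- If `V` is skew-symmetric and `A = V K^* K`, then `A` is skew-symmetric for `⟨K f, K g⟩`. -/
theorem skew_of_generator
    (hV : ∀ f g : V.domain, ⟪V f, (g : L)⟫_ℂ = -⟪(f : L), V g⟫_ℂ)
    (hA : ∀ f, ∃ h : ContinuousLinearMap.adjoint K (K f) ∈ V.domain, V ⟨_, h⟩ = A f) (f g : L) :
    ⟪K (A f), K g⟫_ℂ = -⟪K f, K (A g)⟫_ℂ := by
  obtain ⟨hf, hf'⟩ := hA f
  obtain ⟨hg, hg'⟩ := hA g
  rw [← ContinuousLinearMap.adjoint_inner_right K, ← ContinuousLinearMap.adjoint_inner_left K,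
    ← hf', ← hg']
  exact hV ⟨_, hf⟩ ⟨_, hg⟩

/-- This is $GV\subseteq-(VG)^*$, from moving `V` across the inner product against $Gg$. -/
theorem adjoint_comp_generator
    (hV : ∀ f g : V.domain, ⟪V f, (g : L)⟫_ℂ = -⟪(f : L), V g⟫_ℂ)
    (hA : ∀ f, ∃ h : ContinuousLinearMap.adjoint K (K f) ∈ V.domain, V ⟨_, h⟩ = A f)
    (f : V.domain) :
    ContinuousLinearMap.adjoint K (K (V f)) = ContinuousLinearMap.adjoint (-A) (f : L) := by
  refine ext_inner_left ℂ fun g => ?_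
  obtain ⟨hg, hg'⟩ := hA g
  rw [ContinuousLinearMap.adjoint_inner_right, ContinuousLinearMap.adjoint_inner_right,
    ← ContinuousLinearMap.adjoint_inner_left, neg_apply, inner_neg_left, ← hg', hV ⟨_, hg⟩ f,
    neg_neg]

theorem adjoint_comp_transport
    (hV : ∀ f g : V.domain, ⟪V f, (g : L)⟫_ℂ = -⟪(f : L), V g⟫_ℂ)
    (hA : ∀ f, ∃ h : ContinuousLinearMap.adjoint K (K f) ∈ V.domain, V ⟨_, h⟩ = A f)
    {W : H →L[ℂ] H} (hW : ∀ f, W (K f) = K (A f))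
    (hW0 : ∀ u, ContinuousLinearMap.adjoint K u = 0 → W u = 0) :
    ContinuousLinearMap.adjoint K ∘L W
      = ContinuousLinearMap.adjoint (-A) ∘L ContinuousLinearMap.adjoint K := by
  refine eq_of_eq_on_range_of_eq_on_ker (K := K) (fun f => ?_) (fun u hu => ?_)
  · obtain ⟨hf, hf'⟩ := hA f
    rw [ContinuousLinearMap.comp_apply, ContinuousLinearMap.comp_apply, hW, ← hf',
      adjoint_comp_generator hV hA]
  · rw [ContinuousLinearMap.comp_apply, ContinuousLinearMap.comp_apply, hW0 u hu, hu, map_zero,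
      map_zero]

/-- Skew-adjointness moves `W` onto the test vector, where it is known: on $Kf$ it is $KVGf$, and on
$\ker K^*$ it is zero. -/
theorem transport_apply_of_mem_domain
    (hV : ∀ f g : V.domain, ⟪V f, (g : L)⟫_ℂ = -⟪(f : L), V g⟫_ℂ)
    (hA : ∀ f, ∃ h : ContinuousLinearMap.adjoint K (K f) ∈ V.domain, V ⟨_, h⟩ = A f)
    {W : H →L[ℂ] H} (hW : ∀ f, W (K f) = K (A f))
    (hW0 : ∀ u, ContinuousLinearMap.adjoint K u = 0 → W u = 0) {u : H}
    (hu : ContinuousLinearMap.adjoint K u ∈ V.domain) : W u = K (V ⟨_, hu⟩) := by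
  have hadj := adjoint_transport (skew_of_generator hV hA) hW hW0
  have hWu : ∀ v, ⟪W u, v⟫_ℂ = -⟪u, W v⟫_ℂ := fun v => by
    rw [← ContinuousLinearMap.adjoint_inner_right, hadj, neg_apply, inner_neg_right]
  have key : innerSL ℂ (W u) = innerSL ℂ (K (V ⟨_, hu⟩)) := by
    refine eq_of_eq_on_range_of_eq_on_ker (K := K) (fun f => ?_) (fun v hv => ?_)
    · obtain ⟨hf, hf'⟩ := hA f
      rw [innerSL_apply_apply, innerSL_apply_apply, hWu, hW,
        ← ContinuousLinearMap.adjoint_inner_right K, ← ContinuousLinearMap.adjoint_inner_left K,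
        ← hf']
      exact (hV ⟨_, hu⟩ ⟨_, hf⟩).symm
    · rw [innerSL_apply_apply, innerSL_apply_apply, hWu, hW0 v hv,
        ← ContinuousLinearMap.adjoint_inner_right K, hv, inner_zero_right, inner_zero_right,
        neg_zero]
  refine ext_inner_right ℂ fun v => ?_
  exact DFunLike.congr_fun key v

/-- The domain contains both $\operatorname{ran}K$ and its orthogonal complement $\ker K^*$. -/
theorem dense_adjoint_preimage_domain
    (hA : ∀ f, ContinuousLinearMap.adjoint K (K f) ∈ V.domain) :
    Dense ((V.domain.comap (ContinuousLinearMap.adjoint K : H →ₗ[ℂ] L) : Submodule ℂ H) : Set H) := by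
  rw [Submodule.dense_iff_topologicalClosure_eq_top, Submodule.topologicalClosure_eq_top_iff,
    Submodule.eq_bot_iff]
  intro v hv
  have key : innerSL ℂ v = 0 := by
    refine eq_of_eq_on_range_of_eq_on_ker (K := K) (fun f => ?_) (fun u hu => ?_)
    · exact Submodule.inner_left_of_mem_orthogonal (K := V.domain.comap _) (hA f) hv
    · refine Submodule.inner_left_of_mem_orthogonal (K := V.domain.comap _) ?_ hv
      rw [Submodule.mem_comap]
      exact hu ▸ V.domain.zero_mem
  exact inner_self_eq_zero.1 (DFunLike.congr_fun key v)

end GeneratorTransport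

/-! ### Partially defined operators with a bounded extension -/

section BoundedExtension

variable {E F : Type*} [NormedAddCommGroup E] [NormedSpace ℂ E] [NormedAddCommGroup F]
  [NormedSpace ℂ F]

theorem le_everywhereDefined {T : E →ₗ.[ℂ] F} {B : E →L[ℂ] F} (h : ∀ x : T.domain, T x = B x) :
    T ≤ everywhereDefined B := by
  refine ⟨fun _ _ => Submodule.mem_top, fun x y hxy => ?_⟩
  rw [h, hxy]
  rfl

theorem isClosed_everywhereDefined (B : E →L[ℂ] F) : (everywhereDefined B).IsClosed := by
  have : ((everywhereDefined B).graph : Set (E × F)) = {p | B p.1 = p.2} := by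
    ext p
    rw [SetLike.mem_coe, LinearPMap.mem_graph_iff]
    constructor
    · rintro ⟨y, hy1, hy2⟩
      rw [mem_ofPred_eq, ← hy1]
      exact hy2
    · intro h
      exact ⟨⟨p.1, Submodule.mem_top⟩, rfl, h⟩
  rw [LinearPMap.IsClosed, this]
  exact isClosed_eq (B.continuous.comp continuous_fst) continuous_snd

/-- A bounded operator is the only closed extension of its restrictions to dense subspaces. -/
theorem eq_everywhereDefined_of_isClosed {S T : E →ₗ.[ℂ] F} {B : E →L[ℂ] F}
    (h : T ≤ everywhereDefined B) (hT : Dense (T.domain : Set E)) (hS : S.IsClosed) (hTS : T ≤ S) :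
    S = everywhereDefined B := by
  symm
  -- The graph of `B` lies in the closure of the graph of `T`, hence in the closed graph of `S`.
  have key : ∀ x : E, (x, B x) ∈ S.graph := by
    intro x
    have hmaps : MapsTo (fun x => (x, B x)) (T.domain : Set E) (S.graph : Set (E × F)) := by
      intro y hy
      refine LinearPMap.le_graph_of_le hTS ?_
      rw [LinearPMap.mem_graph_iff]
      exact ⟨⟨y, hy⟩, rfl, h.2 (x := ⟨y, hy⟩) (y := ⟨y, Submodule.mem_top⟩) rfl⟩
    have := map_mem_closure (continuous_id.prodMk B.continuous) (hT x) hmaps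
    exact (IsClosed.closure_eq hS ▸ this : _)
  refine LinearPMap.eq_of_le_of_domain_eq (LinearPMap.le_of_le_graph ?_) ?_
  · intro p hp
    rw [LinearPMap.mem_graph_iff] at hp
    obtain ⟨y, hy1, hy2⟩ := hp
    have : p = ((y : E), B y) := Prod.ext hy1.symm hy2.symm
    rw [this]
    exact key _
  · refine ((eq_top_iff.2 fun x _ => ?_ : S.domain = ⊤)).symm
    exact LinearPMap.mem_domain_of_mem_graph (key x)

theorem isClosable_of_le_everywhereDefined {T : E →ₗ.[ℂ] F} {B : E →L[ℂ] F}
    (h : T ≤ everywhereDefined B) : T.IsClosable :=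
  (isClosed_everywhereDefined B).isClosable.leIsClosable h

theorem everywhereDefined_eq_closure {T : E →ₗ.[ℂ] F} {B : E →L[ℂ] F}
    (h : T ≤ everywhereDefined B) (hT : Dense (T.domain : Set E)) :
    everywhereDefined B = T.closure :=
  (eq_everywhereDefined_of_isClosed h hT (isClosable_of_le_everywhereDefined h).closure_isClosed
    T.le_closure).symm

end BoundedExtension

/-! ### Double adjoints and the Nyström operator -/

section Nystrom

variable {L H : Type*} [NormedAddCommGroup L] [InnerProductSpace ℂ L] [CompleteSpace L]
  [NormedAddCommGroup H] [InnerProductSpace ℂ H] [CompleteSpace H]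

/-- A densely defined restriction of `B` has the same adjoint as `B`. -/
theorem everywhereDefined_eq_adjoint_adjoint {T : L →ₗ.[ℂ] H} {B : L →L[ℂ] H}
    (h : T ≤ everywhereDefined B) (hT : Dense (T.domain : Set L)) : everywhereDefined B = T†† := by
  have hTB : T = (B : L →ₗ[ℂ] H).toPMap T.domain :=
    LinearPMap.eq_of_le_of_domain_eq ⟨fun x hx => hx, fun x y hxy => by
      exact h.2 (x := x) (y := ⟨y, Submodule.mem_top⟩) hxy⟩ rfl
  rw [hTB, B.toPMap_adjoint_eq_adjoint_toPMap_of_dense hT,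
    ContinuousLinearMap.toPMap_adjoint_eq_adjoint_toPMap_of_dense _ (by simp),
    ContinuousLinearMap.adjoint_adjoint]
  rfl

variable (K : L →L[ℂ] H)

/-- $\ker K^*=(\operatorname{ran}K)^\perp$ meets the closure of $\operatorname{ran}K$ only in $0$.
This is what makes `nystromOp` a genuine inverse. -/
theorem adjoint_injOn_closure_range :
    LinearMap.ker ((ContinuousLinearMap.adjoint K : H →ₗ[ℂ] L).toPMap
      (LinearMap.range (K : L →ₗ[ℂ] H)).topologicalClosure).toFun = ⊥ := by
  rw [LinearMap.ker_eq_bot']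
  intro x hx
  have hx0 : ContinuousLinearMap.adjoint K (x : H) = 0 := hx
  have h1 : (x : H) ∈ ((LinearMap.range (K : L →ₗ[ℂ] H)).topologicalClosure)ᗮ := by
    rw [Submodule.orthogonal_closure,
      show (LinearMap.range (K : L →ₗ[ℂ] H))ᗮ = _ from K.orthogonal_range]
    exact hx0
  exact Subtype.ext (inner_self_eq_zero.1 (Submodule.inner_right_of_mem_orthogonal x.2 h1))

theorem adjoint_nystromOp (f : (nystromOp K).domain) :
    ContinuousLinearMap.adjoint K (nystromOp K f) = f := by
  obtain ⟨x, hx⟩ := LinearPMap.inverse_domain.le f.2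
  have := LinearPMap.inverse_apply_eq (adjoint_injOn_closure_range K) (y := f) (x := x) hx
  rw [show nystromOp K f = x from this]
  exact hx

theorem mem_nystromOp_domain (f : L) :
    ContinuousLinearMap.adjoint K (K f) ∈ (nystromOp K).domain := by
  unfold nystromOp
  rw [LinearPMap.inverse_domain]
  exact ⟨⟨K f, Submodule.le_topologicalClosure _ (LinearMap.mem_range_self (K : L →ₗ[ℂ] H) f)⟩, rfl⟩

/-- Both sides say that `K` is injective: $\langle f,Gf\rangle=\|Kf\|^2$, and
$(\operatorname{ran}K^*)^\perp=\ker K$. -/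
theorem isStrictlyPositiveOp_iff_dense_nystromOp_domain :
    IsStrictlyPositiveOp (ContinuousLinearMap.adjoint K ∘L K)
      ↔ Dense ((nystromOp K).domain : Set L) := by
  have hinner : ∀ f : L, ⟪f, (ContinuousLinearMap.adjoint K ∘L K) f⟫_ℂ = ((‖K f‖ ^ 2 : ℝ) : ℂ) := by
    intro f
    rw [ContinuousLinearMap.comp_apply, ContinuousLinearMap.adjoint_inner_right,
      inner_self_eq_norm_sq_to_K]
    simp
  rw [Submodule.dense_iff_topologicalClosure_eq_top, Submodule.topologicalClosure_eq_top_iff,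
    Submodule.eq_bot_iff]
  constructor
  · intro h f hf
    by_contra hne
    have h1 := (h f hne).1
    rw [ContinuousLinearMap.comp_apply,
      Submodule.inner_left_of_mem_orthogonal (mem_nystromOp_domain K f) hf] at h1
    exact lt_irrefl _ h1
  · intro h f hne
    rw [hinner]
    refine ⟨?_, Complex.ofReal_im _⟩
    rw [Complex.ofReal_re]
    have : K f ≠ 0 := by
      intro h0
      refine hne (h f ?_)
      rw [Submodule.mem_orthogonal]
      intro g hg
      rw [show g = _ from (adjoint_nystromOp K ⟨g, hg⟩).symm, ContinuousLinearMap.adjoint_inner_left, h0,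
        inner_zero_right]
    positivity

theorem postcompBounded_nystromOp_le {P : H →L[ℂ] L} {B : L →L[ℂ] L}
    (h : P = B ∘L ContinuousLinearMap.adjoint K) :
    postcompBounded P (nystromOp K) ≤ everywhereDefined B := by
  refine le_everywhereDefined fun f => ?_
  change P (nystromOp K f) = _
  rw [h, ContinuousLinearMap.comp_apply, adjoint_nystromOp K f]

theorem postcompBounded_nystromOp_eq {P : H →L[ℂ] L} {B : L →L[ℂ] L}
    (h : P = B ∘L ContinuousLinearMap.adjoint K) :
    postcompBounded P (nystromOp K)
      = (everywhereDefined B).domRestrict (nystromOp K).domain := by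
  have hdom : ((everywhereDefined B).domRestrict (nystromOp K).domain).domain
      = (nystromOp K).domain := by
    rw [LinearPMap.domRestrict_domain]
    exact inf_top_eq _
  refine LinearPMap.eq_of_le_of_domain_eq ⟨hdom.ge, fun x y hxy => ?_⟩ hdom.symm
  have h1 := (postcompBounded_nystromOp_le K h).2 (x := x) (y := ⟨x, Submodule.mem_top⟩) rfl
  exact h1.trans (LinearPMap.domRestrict_apply (x := y) (y := ⟨x, Submodule.mem_top⟩) hxy.symm).symm

end Nystrom

/-! ### Exponentials of bounded operators -/

section Exponential

/-- The intertwining passes to powers, then termwise to the exponential series. -/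
theorem comp_exp_eq_exp_comp {E F : Type*} [NormedAddCommGroup E] [NormedSpace ℂ E]
    [CompleteSpace E] [NormedAddCommGroup F] [NormedSpace ℂ F] [CompleteSpace F]
    {J : E →L[ℂ] F} {W : E →L[ℂ] E} {B : F →L[ℂ] F} (h : J ∘L W = B ∘L J) :
    J ∘L NormedSpace.exp W = NormedSpace.exp B ∘L J := by
  have hpow : ∀ (n : ℕ) (x : E), J ((W ^ n) x) = (B ^ n) (J x) := by
    intro n
    induction n with
    | zero => intro x; rfl
    | succ n ih =>
      intro x
      rw [pow_succ', pow_succ', mul_apply_eq_comp, mul_apply_eq_comp, ← ih]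
      exact DFunLike.congr_fun h _
  ext x
  have h1 := ((NormedSpace.exp_series_hasSum_exp' (𝕂 := ℂ) W).mapL
    (ContinuousLinearMap.apply ℂ E x)).mapL J
  have h2 := (NormedSpace.exp_series_hasSum_exp' (𝕂 := ℂ) B).mapL
    (ContinuousLinearMap.apply ℂ F (J x))
  refine h1.unique (h2.congr_fun fun n => ?_)
  simp only [ContinuousLinearMap.apply_apply, map_smul, hpow]

theorem exp_group {E : Type*} [NormedAddCommGroup E] [NormedSpace ℂ E] [CompleteSpace E]
    (B : E →L[ℂ] E) :
    NormedSpace.exp (((0 : ℝ) : ℂ) • B) = 1 ∧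
      (∀ s t : ℝ, NormedSpace.exp (((s + t : ℝ) : ℂ) • B)
        = NormedSpace.exp ((s : ℂ) • B) ∘L NormedSpace.exp ((t : ℂ) • B)) ∧
      (Continuous fun t : ℝ => NormedSpace.exp ((t : ℂ) • B)) ∧
      HasDerivAt (fun t : ℝ => NormedSpace.exp ((t : ℂ) • B)) B 0 := by
  have : NormedAlgebra ℚ (E →L[ℂ] E) := NormedAlgebra.restrictScalars ℚ ℂ _
  refine ⟨?_, fun s t => ?_, ?_, ?_⟩
  · rw [Complex.ofReal_zero, zero_smul, NormedSpace.exp_zero]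
  · rw [Complex.ofReal_add, add_smul, NormedSpace.exp_add_of_commute]
    · rfl
    · exact ((Commute.refl B).smul_left _).smul_right _
  · exact NormedSpace.exp_continuous.comp (by fun_prop)
  · have h := HasDerivAt.scomp (0 : ℝ) (hasDerivAt_exp_smul_const (𝕂 := ℂ) B ((0 : ℝ) : ℂ))
      Complex.ofRealCLM.hasDerivAt
    simpa [Function.comp_def] using h

end Exponential

/-! ### Transport of the generator to the reproducing kernel Hilbert space -/

section KernelGenerator

variable {M Y H : Type*} [TopologicalSpace M] [MetricSpace Y] [CompactSpace Y]
  [MeasurableSpace Y] [BorelSpace Y] [NormedAddCommGroup H] [InnerProductSpace ℂ H]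
  [CompleteSpace H] [RKHS ℂ H M ℂ] {k k' : M → M → ℝ}

/-- The restriction to `Y × Y` of a continuous real kernel on `M × M`, as a complex function. -/
def restrictKernel (hk : Continuous fun p : M × M => k p.1 p.2) (j : C(Y, M)) : C(Y × Y, ℂ) :=
  ⟨fun p => (k (j p.1) (j p.2) : ℂ), Complex.continuous_ofReal.comp
    (hk.comp ((j.continuous.comp continuous_fst).prodMk (j.continuous.comp continuous_snd)))⟩

/-- The section `k(·, x)` of a continuous real kernel, restricted to `Y`, as a complex function. -/
def restrictSection (hk : Continuous fun p : M × M => k p.1 p.2) (j : C(Y, M)) (x : M) : C(Y, ℂ) :=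
  ⟨fun y => (k (j y) x : ℂ), Complex.continuous_ofReal.comp
    (hk.comp (j.continuous.prodMk continuous_const))⟩

variable (hH : HasReproducingKernel H k) (hk : Continuous fun p : M × M => k p.1 p.2)
  (hk' : Continuous fun p : M × M => k' p.1 p.2) (j : C(Y, M)) (μ : Measure Y) [IsFiniteMeasure μ]

theorem adjoint_rkhsIntegralOp_apply (f : Lp ℂ 2 μ) :
    ContinuousLinearMap.adjoint (rkhsIntegralOp hH hk j μ) (rkhsIntegralOp hH hk j μ f)
      = ContinuousMap.toLp 2 μ ℂ (kernelIntegral μ (restrictKernel hk j) f) := by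
  apply Lp.ext
  filter_upwards [rkhsIntegralOp_adjoint hH hk j μ (rkhsIntegralOp hH hk j μ f),
    ContinuousMap.coeFn_toLp (p := 2) μ (𝕜 := ℂ) (kernelIntegral μ (restrictKernel hk j) f)]
    with x h1 h2
  rw [h1, h2, rkhsIntegralOp_apply, kernelIntegral_apply]
  rfl

theorem adjoint_rkhsIntegralOp_kerFun (x : M) :
    ContinuousLinearMap.adjoint (rkhsIntegralOp hH hk j μ) (RKHS.kerFun H x (1 : ℂ))
      = ContinuousMap.toLp 2 μ ℂ (restrictSection hk j x) := by
  apply Lp.ext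
  filter_upwards [rkhsIntegralOp_adjoint hH hk j μ (RKHS.kerFun H x (1 : ℂ)),
    ContinuousMap.coeFn_toLp (p := 2) μ (𝕜 := ℂ) (restrictSection hk j x)] with y h1 h2
  rw [h1, h2, hH]
  rfl

variable {φ : Flow ℝ Y} (hμ : ∀ t : ℝ, MeasurePreserving (φ t) μ μ)
  (hder : ∀ ε > 0, ∃ δ > 0, ∀ t : ℝ, |t| < δ → ∀ (y : Y) (x : M),
    |k (j (φ t y)) x - k (j y) x - t * k' (j y) x| ≤ ε * |t|)

include hμ hder

theorem koopmanGenerator_adjoint_rkhsIntegralOp (f : Lp ℂ 2 μ) :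
    ∃ h : ContinuousLinearMap.adjoint (rkhsIntegralOp hH hk j μ) (rkhsIntegralOp hH hk j μ f)
        ∈ (koopmanGenerator hμ).domain,
      koopmanGenerator hμ ⟨_, h⟩ = kernelOp μ (restrictKernel hk' j) f := by
  have h1 := tendsto_koopmanQuotient_toLp hμ _ _
    (kernelIntegral_uniform_derivative μ (φ := φ) (c := restrictKernel hk j)
      (c' := restrictKernel hk' j) (fun ε hε => by
        obtain ⟨δ, hδ, h⟩ := hder ε hε
        refine ⟨δ, hδ, fun t ht x y => ?_⟩
        have := h t ht x (j y)
        rw [← Real.norm_eq_abs, ← Complex.norm_real] at this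
        simpa [restrictKernel] using this) f)
  rw [← adjoint_rkhsIntegralOp_apply hH hk j μ f] at h1
  exact ⟨mem_koopmanGenerator_domain h1, koopmanGenerator_apply h1⟩

/-- Needed for all $x\in M$, not only on the support set, so that $Wh$ can be evaluated at every
point of $M$. -/
theorem koopmanGenerator_adjoint_kerFun (x : M) :
    ∃ h : ContinuousLinearMap.adjoint (rkhsIntegralOp hH hk j μ) (RKHS.kerFun H x (1 : ℂ))
        ∈ (koopmanGenerator hμ).domain,
      koopmanGenerator hμ ⟨_, h⟩ = ContinuousMap.toLp 2 μ ℂ (restrictSection hk' j x) := by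
  have h1 := tendsto_koopmanQuotient_toLp hμ (restrictSection hk j x) (restrictSection hk' j x)
    (fun ε hε => by
      obtain ⟨δ, hδ, h⟩ := hder ε hε
      refine ⟨δ, hδ, fun t ht y => ?_⟩
      have := h t ht y x
      rw [← Real.norm_eq_abs, ← Complex.norm_real] at this
      simpa [restrictSection] using this)
  rw [← adjoint_rkhsIntegralOp_kerFun hH hk j μ x] at h1
  exact ⟨mem_koopmanGenerator_domain h1, koopmanGenerator_apply h1⟩

/-- With $k_x=k(\cdot,x)$: $(Wh)(x)=\langle k_x,Wh\rangle=-\langle Wk_x,h\rangle=-\langle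
VK^*k_x,K^*h\rangle$, and $VK^*k_x=k'(\cdot,x)$. -/
theorem transport_apply_eq_integral {W : H →L[ℂ] H}
    (hW : ∀ f, W (rkhsIntegralOp hH hk j μ f)
      = rkhsIntegralOp hH hk j μ (kernelOp μ (restrictKernel hk' j) f))
    (hW0 : ∀ u, ContinuousLinearMap.adjoint (rkhsIntegralOp hH hk j μ) u = 0 → W u = 0)
    (h : H) (x : M) : W h x = ∫ y, ((-k' (j y) x : ℝ) : ℂ) * h (j y) ∂μ := by
  have hV := inner_koopmanGenerator hμ
  have hA := koopmanGenerator_adjoint_rkhsIntegralOp hH hk hk' j μ hμ hder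
  have hadj := adjoint_transport (skew_of_generator hV hA) hW hW0
  obtain ⟨hx, hx'⟩ := koopmanGenerator_adjoint_kerFun hH hk hk' j μ hμ hder x
  have h1 : W h x = ⟪(RKHS.kerFun H x (1 : ℂ) : H), W h⟫_ℂ := by simp
  have h2 : star (restrictSection hk' j x) = restrictSection hk' j x := by
    ext y
    exact Complex.conj_ofReal _
  rw [h1, ← ContinuousLinearMap.adjoint_inner_left, hadj, neg_apply, inner_neg_left,
    transport_apply_of_mem_domain hV hA hW hW0 hx, hx',
    ← ContinuousLinearMap.adjoint_inner_right (rkhsIntegralOp hH hk j μ), ← h2, inner_toLp_star,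
    ← integral_neg]
  refine integral_congr_ae ?_
  filter_upwards [rkhsIntegralOp_adjoint hH hk j μ h] with y hy
  rw [hy]
  simp [restrictSection]

end KernelGenerator

end
-- The main theorem
theorem theorem7
    {S : Type*} [MetricSpace S] [MeasurableSpace S] [BorelSpace S] (Φ : Flow ℝ S)
    {m : ℕ} {E₀ : Type*} [TopologicalSpace E₀]
    (I : ModelWithCorners ℝ (EuclideanSpace ℝ (Fin m)) E₀)
    (M : Set S) [ChartedSpace E₀ M] [IsManifold I 1 M] [CompactSpace M] [ConnectedSpace M]
    (hM : IsForwardInvariant Φ M)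
    (hΦ : ContMDiffOn (𝓘(ℝ, ℝ).prod I) I 1
      (fun p : ℝ × M => semiflowOn Φ hM p.1 p.2) (Ici (0 : ℝ) ×ˢ univ))
    (X : Set S) [CompactSpace X] (hXM : X ⊆ M) (hX : IsInvariant Φ X)
    (μ : Measure X) [IsProbabilityMeasure μ]
    (hμ : ∀ t : ℝ, MeasurePreserving (Φ.restrict hX t) μ μ)
    (hμ_erg : IsErgodicFlow (Φ.restrict hX) μ)
    (k : M → M → ℝ)
    (hk : ContMDiff (I.prod I) 𝓘(ℝ, ℝ) 1 (fun p : M × M => k p.1 p.2))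
    (hk_symm : ∀ x y, k x y = k y x) (hk_pos : IsPosDefKernel k)
    {H : Type*} [NormedAddCommGroup H] [InnerProductSpace ℂ H] [CompleteSpace H]
    [RKHS ℂ H M ℂ] (hH : HasReproducingKernel H k) :
    let j : C(X, M) := ⟨Set.inclusion hXM, continuous_inclusion hXM⟩
    let V : Lp ℂ 2 μ →ₗ.[ℂ] Lp ℂ 2 μ := koopmanGenerator hμ
    let K : Lp ℂ 2 μ →L[ℂ] H := rkhsIntegralOp hH hk.continuous j μ
    let Kadj : H →L[ℂ] Lp ℂ 2 μ := ContinuousLinearMap.adjoint K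
    let G : Lp ℂ 2 μ →L[ℂ] Lp ℂ 2 μ := Kadj ∘L K
    let GV : Lp ℂ 2 μ →ₗ.[ℂ] Lp ℂ 2 μ := postcompBounded G V
    let KVKadj : H →ₗ.[ℂ] H := postcompBounded K (precompBounded V Kadj)
    let N : Lp ℂ 2 μ →ₗ.[ℂ] H := nystromOp K
    let k' : M → M → ℝ := fun x y => derivAlongFlow Φ hM (fun z => k z y) x
    let kt' : M → M → ℝ := fun x y => -k' y x
    ∃ (A B : Lp ℂ 2 μ →L[ℂ] Lp ℂ 2 μ) (W : H →L[ℂ] H),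
      -- `A = V G`, everywhere defined and bounded
      everywhereDefined A = precompBounded V G ∧
      -- `W` is the unique bounded extension of the densely defined operator `K V K^*`,
      -- given by integration against `kt'`
      (Dense (KVKadj.domain : Set H) ∧ KVKadj ≤ everywhereDefined W ∧
        ∀ (h : H) (x : M), W h x = ∫ y, (kt' x (j y) : ℂ) * h (j y) ∂μ) ∧
      -- `B = -A^*` is a Hilbert-Schmidt integral operator with the continuous kernel `kt'`
      B = ContinuousLinearMap.adjoint (-A) ∧
      IsHilbertSchmidt B ∧
      (∀ x y : M, HasDerivWithinAt (fun t : ℝ => k (semiflowOn Φ hM t x) y) (k' x y) (Ici 0) 0) ∧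
      (Continuous fun p : M × M => kt' p.1 p.2) ∧
      (∀ f : Lp ℂ 2 μ, ⇑(B f) =ᵐ[μ] fun x => ∫ y, (kt' (j x) (j y) : ℂ) * f y ∂μ) ∧
      -- `G V` is densely defined and bounded, and `B` is its closure `(G V)^**`
      Dense (GV.domain : Set (Lp ℂ 2 μ)) ∧
      (∃ C : ℝ, ∀ f : GV.domain, ‖GV f‖ ≤ C * ‖(f : Lp ℂ 2 μ)‖) ∧
      GV.IsClosable ∧ everywhereDefined B = GV.closure ∧ everywhereDefined B = GV†† ∧
      -- `B` is a closed extension of `K^* W N`, unique if `k` is strictly positive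
      (everywhereDefined B).IsClosed ∧
      postcompBounded (Kadj ∘L W) N ≤ everywhereDefined B ∧
      (IsStrictlyPositiveOp G ↔ Dense (N.domain : Set (Lp ℂ 2 μ))) ∧
      (IsStrictlyPositiveOp G → ∀ T : Lp ℂ 2 μ →ₗ.[ℂ] Lp ℂ 2 μ, T.IsClosed →
        postcompBounded (Kadj ∘L W) N ≤ T → T = everywhereDefined B) ∧
      -- `B` generates the norm-continuous group `e^{tB}`
      (NormedSpace.exp (((0 : ℝ) : ℂ) • B) = 1 ∧
        (∀ s t : ℝ, NormedSpace.exp (((s + t : ℝ) : ℂ) • B)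
          = NormedSpace.exp ((s : ℂ) • B) ∘L NormedSpace.exp ((t : ℂ) • B)) ∧
        (Continuous fun t : ℝ => NormedSpace.exp ((t : ℂ) • B)) ∧
        HasDerivAt (fun t : ℝ => NormedSpace.exp ((t : ℂ) • B)) B 0) ∧
      -- intertwining with the group `e^{tW}`
      (∀ t : ℝ, Kadj ∘L NormedSpace.exp ((t : ℂ) • W)
        = NormedSpace.exp ((t : ℂ) • B) ∘L Kadj) ∧
      (∀ t : ℝ, postcompBounded (Kadj ∘L NormedSpace.exp ((t : ℂ) • W)) N
        = (everywhereDefined (NormedSpace.exp ((t : ℂ) • B))).domRestrict N.domain) := by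
  intro j V K Kadj G GV KVKadj N k' kt'
  have hd : ∀ x y, HasDerivWithinAt (fun t : ℝ => k (semiflowOn Φ hM t x) y) (k' x y) (Ici 0) 0 :=
    hasDerivWithinAt_kernel_semiflowOn hM hΦ hk
  have hk' : Continuous fun p : M × M => k' p.1 p.2 := continuous_derivAlongFlow hM hΦ hk
  have hder : ∀ ε > 0, ∃ δ > 0, ∀ t : ℝ, |t| < δ → ∀ (y : X) (x : M),
      |k (j (Φ.restrict hX t y)) x - k (j y) x - t * k' (j y) x| ≤ ε * |t| := fun ε hε =>
    exists_uniform_derivative_two_sided hM hk.continuous hd hk' hXM hX hε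
  obtain ⟨A, hAdef⟩ : ∃ A : Lp ℂ 2 μ →L[ℂ] Lp ℂ 2 μ, A = kernelOp μ (restrictKernel hk' j) :=
    ⟨_, rfl⟩
  have hV : ∀ f g : V.domain, ⟪V f, (g : Lp ℂ 2 μ)⟫_ℂ = -⟪(f : Lp ℂ 2 μ), V g⟫_ℂ :=
    inner_koopmanGenerator hμ
  have hVdense : Dense (V.domain : Set (Lp ℂ 2 μ)) := dense_koopmanGenerator_domain hμ
  have hA : ∀ f, ∃ h : Kadj (K f) ∈ V.domain, V ⟨_, h⟩ = A f := by
    rw [hAdef]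
    exact koopmanGenerator_adjoint_rkhsIntegralOp hH hk.continuous hk' j μ hμ hder
  obtain ⟨W, hW, hW0⟩ := exists_transport (skew_of_generator hV hA)
  obtain ⟨B, hBdef⟩ : ∃ B : Lp ℂ 2 μ →L[ℂ] Lp ℂ 2 μ, B = ContinuousLinearMap.adjoint (-A) :=
    ⟨_, rfl⟩
  have hkt' : Continuous fun p : M × M => kt' p.1 p.2 := (hk'.comp continuous_swap).neg
  -- The adjoint transposes the real kernel $-k'$, which gives $\tilde k'$.
  have hB : B = kernelOp μ (restrictKernel hkt' j) := by
    rw [hBdef, hAdef, ← kernelOp_neg]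
    refine adjoint_kernelOp μ fun x y => ?_
    simp [restrictKernel, kt']
  have hGV : GV ≤ everywhereDefined B := le_everywhereDefined fun f => by
    rw [hBdef]
    exact adjoint_comp_generator hV hA f
  have hKW : Kadj ∘L W = B ∘L Kadj := by
    rw [hBdef]
    exact adjoint_comp_transport hV hA hW hW0
  have hexp : ∀ t : ℝ, Kadj ∘L NormedSpace.exp ((t : ℂ) • W)
      = NormedSpace.exp ((t : ℂ) • B) ∘L Kadj := fun t =>
    comp_exp_eq_exp_comp (by rw [ContinuousLinearMap.comp_smul, hKW, ContinuousLinearMap.smul_comp])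
  refine ⟨A, B, W, ?_, ⟨dense_adjoint_preimage_domain fun f => (hA f).1, ?_, ?_⟩, hBdef, ?_, hd, hkt',
    ?_, hVdense, ?_, isClosable_of_le_everywhereDefined hGV, everywhereDefined_eq_closure hGV hVdense,
    everywhereDefined_eq_adjoint_adjoint hGV hVdense, isClosed_everywhereDefined B,
    postcompBounded_nystromOp_le K hKW, isStrictlyPositiveOp_iff_dense_nystromOp_domain K,
    fun hpos T hT hNT => ?_, exp_group B, hexp, fun t => postcompBounded_nystromOp_eq K (hexp t)⟩
  · symm
    have hle : precompBounded V G ≤ everywhereDefined A := le_everywhereDefined fun f => (hA f).2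
    exact LinearPMap.eq_of_le_of_domain_eq hle (eq_top_iff.2 fun f _ => (hA f).1)
  · exact le_everywhereDefined fun u => (transport_apply_of_mem_domain hV hA hW hW0 u.2).symm
  · exact transport_apply_eq_integral hH hk.continuous hk' j μ hμ hder (hAdef ▸ hW) hW0
  · rw [hB]
    exact isHilbertSchmidt_kernelOp μ _
  · rw [hB]
    exact coeFn_kernelOp μ _
  · exact ⟨‖B‖, fun f => by
      rw [show GV f = B f from hGV.2 (x := f) (y := ⟨f, Submodule.mem_top⟩) rfl]
      exact B.le_opNorm _⟩
  · exact eq_everywhereDefined_of_isClosed (postcompBounded_nystromOp_le K hKW)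
      ((isStrictlyPositiveOp_iff_dense_nystromOp_domain K).1 hpos) hT hNT
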